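/- **Setting.** Let $M$ be a smooth manifold and $A\to M$ a smooth real vector bundle of finite rank with a Lie algebroid structure $\mu$: a vector bundle morphism $\rho:A\to TM$ (the anchor) and an $\mathbb R$-bilinear skew-symmetric bracket $[X,Y]^\mu$ on $\Gamma(A)$ that satisfies the Jacobi identity and $[X,fY]^\mu=f[X,Y]^\mu+(\rho(X)\cdot f)Y$. Let $N$ be a vector bundle endomorphism of $A$ (over $\mathrm{Id}_M$). *Deformation, torsion.* For a bracket $[\ ,\ ]$ on sections and an endomorphism $\mathcal N$, put $$[u,v]_{\mathcal N}=[\mathcal Nu,v]+[u,\mathcal Nv]-\mathcal N[u,v],\qquad (T\mathcal N)(u,v)=[\mathcal Nu,\mathcal Nv]-\mathcal N\big([u,v]_{\mathcal N}\big).$$ Write $[\ ,\ ]^\mu_N$ for the bracket $[\ ,\ ]^\mu$ deformed by $N$ and $T_\mu N$ for the torsion of $N$. Denote by $\mu_N$ the bracket $[\ ,\ ]^\mu_N$ on $\Gamma(A)$ with the anchor $\rho\circ N$; it satisfies the Leibniz rule, and is a Lie algebroid structure if it satisfies the Jacobi identity. *Cps structures, irreducibility.* A cps structure on $(A,\mu)$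 is a vector bundle endomorphism $J$ of $A$ with $J^2=\varepsilon\,\mathrm{Id}_A$ for some $\varepsilon\in\{-1,0,1\}$ and $T_\mu J=0$. $N$ is proportional to a cps structure if $N=cJ$ with $c\in\mathbb R$ and $J$ a cps structure. $(A,\mu)$ is irreducible if every vector bundle endomorphism $\psi$ of $A$ such that $\psi[X,Y]^\mu=[X,\psi Y]^\mu$ for all $X,Y\in\Gamma(A)$ is a real constant multiple of $\mathrm{Id}_A$. *Courant structures.* Let $E\to M$ be a vector bundle with a fibrewise nondegenerate symmetric form $\langle\ ,\ \rangle$, and let $\mathcal A$ be the graded algebra of functions on its minimal symplectic realization, with its Poisson bracket $\{\ ,\ \}$ of degree $-2$; thus $\mathcal A^0=C^\infty(M)$, $\mathcal A^1=\Gamma(E)$ and $\{u,v\}=\langle u,v\rangle$ for $u,v\in\Gamma(E)$. An element $\Theta\in\mathcal A^3$ has the derived bracket $[u,v]=\{\{u,\Theta\},v\}$ on $\Gamma(E)$. It is a Courant algebroid structure on $E$ if $\{\Theta,\Theta\}=0$; its derived bracket is then the Dorfman bracket. A skew-symmetric endomorphism $\mathcal N$ of $E$ corresponds to the element $\widetilde{\mathcal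 N}\in\mathcal A^2$ with $\mathcal Nu=\{u,\widetilde{\mathcal N}\}$ for all $u\in\Gamma(E)$ and $\{\widetilde{\mathcal N},f\}=0$ for all $f\in C^\infty(M)$. *Doubles.* Let $E=A\oplus A^*$ with $\langle X+\xi,Y+\eta\rangle=\langle\xi,Y\rangle+\langle\eta,X\rangle$. An anchored skew-symmetric bracket with the Leibniz rule on $A$, or on $A^*$, is identified with an element of $\mathcal A^3$. The double of such brackets $\mu$ on $A$ and $\gamma$ on $A^*$ is $\mu+\gamma\in\mathcal A^3$, and also its derived bracket. The double of the bracket $\mu$ means the case $\gamma=0$, whose derived bracket is $$[X+\xi,Y+\eta]=[X,Y]^\mu+\mathcal L^\mu_X\eta-i_Y\mathrm d_\mu\xi .$$ $((A,\mu),(A^*,\gamma))$ is a Lie bialgebroid if $\mu$ and $\gamma$ are Lie algebroid structures and $\{\mu,\gamma\}=0$; equivalently, if $\mu,\gamma$ are Lie algebroid structures and $\mu+\gamma$ is a Courant algebroid structure. It is trivial if $\gamma=0$. **Statement.** Let $(A,\mu)$ be a Lie algebroid and $N$ a vector bundle endomorphism of $A$. Let $[\ ,\ ]$ be the Dorfman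 bracket of the double of the trivial Lie bialgebroid $((A,\mu),(A^*,0))$, and let $\mathcal N$ be the endomorphism $\mathcal N(X+\xi)=NX-{}^t\!N\xi$ of $A\oplus A^*$, that is, $\mathcal N=\begin{pmatrix}N&0\\0&-{}^t\!N\end{pmatrix}$. Then: (i) The deformed bracket $[\ ,\ ]_{\mathcal N}$ is the double of the bracket $[\ ,\ ]^\mu_N$: for all $X,Y\in\Gamma(A)$ and $\xi,\eta\in\Gamma(A^*)$, $$[X+\xi,Y+\eta]_{\mathcal N}=[X,Y]^{\mu}_N+\mathcal L^{\mu_N}_X\eta-i_Y\mathrm d_{\mu_N}\xi .$$ (ii) If $T_\mu N=0$, then $((A,\mu_N),(A^*,0))$ is a (trivial) Lie bialgebroid. (iii) If $N$ is proportional to a cps structure on $A$, then the torsion of $\mathcal N$ with respect to $[\ ,\ ]$ vanishes. (iv) Conversely, if the torsion of $\mathcal N$ with respect to $[\ ,\ ]$ vanishes and $(A,\mu)$ is irreducible, then $N$ is proportional to a cps structure on $A$. (v) If $N$ is proportional to a cps structure on $A$, then $((A,\mu_N),(A^*,0))$ is a Lie bialgebroid, $\{\widetilde{\mathcal N},\mu\}$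 is a Courant algebroid structure on $A\oplus A^*$, and the double of $((A,\mu_N),(A^*,0))$ is the Courant algebroid $(A\oplus A^*,\{\widetilde{\mathcal N},\mu\})$. -/

import Mathlib

open Bundle Set Topology
open scoped Manifold ContDiff

namespace DoubleDeformation

noncomputable section

set_option linter.unusedSectionVars false

section Bundles

variable {EM : Type*} [NormedAddCommGroup EM] [NormedSpace ℝ EM]
  {H : Type*} [TopologicalSpace H] {I : ModelWithCorners ℝ EM H}
  {M : Type*} [TopologicalSpace M] [ChartedSpace H M]
  {F : Type*} [NormedAddCommGroup F] [NormedSpace ℝ F]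
  {V : M → Type*} [TopologicalSpace (TotalSpace F V)] [∀ x, TopologicalSpace (V x)]
  [∀ x, AddCommGroup (V x)] [∀ x, Module ℝ (V x)] [FiberBundle F V] [VectorBundle ℝ F V]

/-- The sections of a vector bundle form a module over the smooth functions. -/
instance sectionSMul : SMul C^∞⟮I, M; ℝ⟯ Cₛ^∞⟮I; F, V⟯ :=
  ⟨fun f s ↦ ⟨fun x ↦ f x • s x, f.contMDiff.smul_section s.contMDiff⟩⟩

@[simp] theorem section_smul_apply (f : C^∞⟮I, M; ℝ⟯) (s : Cₛ^∞⟮I; F, V⟯) (x : M) :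
    (f • s) x = f x • s x := rfl

instance sectionModule : Module C^∞⟮I, M; ℝ⟯ Cₛ^∞⟮I; F, V⟯ where
  one_smul s := by ext x; simp
  mul_smul f g s := by ext x; simp [mul_smul]
  smul_zero f := by ext x; simp
  smul_add f s t := by ext x; simp
  add_smul f g s := by ext x; simp [add_smul]
  zero_smul s := by ext x; simp

instance sectionTower : IsScalarTower ℝ C^∞⟮I, M; ℝ⟯ Cₛ^∞⟮I; F, V⟯ where
  smul_assoc c f s := by ext x; simp [mul_smul]


/-- The dual bundle `A*` of a vector bundle `A`. -/
abbrev DualBundle (V : M → Type*) [∀ x, TopologicalSpace (V x)]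
    [∀ x, AddCommGroup (V x)] [∀ x, Module ℝ (V x)] (x : M) : Type _ :=
  V x →L[ℝ] Trivial M ℝ x

theorem contMDiffAt_trivial_iff {g : M → ℝ} {x : M} :
    ContMDiffAt I (I.prod 𝓘(ℝ, ℝ)) ∞
      (fun y ↦ (TotalSpace.mk' ℝ y (g y) : TotalSpace ℝ (Trivial M ℝ))) x ↔
      ContMDiffAt I 𝓘(ℝ, ℝ) ∞ g x := by
  rw [contMDiffAt_section]
  rfl

section Global

variable [FiniteDimensional ℝ EM] [T2Space M] [IsManifold I ∞ M]

theorem exists_bump {x : M} {u : Set M} (hu : IsOpen u) (hx : x ∈ u) :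
    ∃ f : C^∞⟮I, M; ℝ⟯, tsupport f ⊆ u ∧ ∀ᶠ y in 𝓝 x, f y = 1 := by
  obtain ⟨f, -, hf⟩ := (SmoothBumpFunction.nhds_basis_tsupport (I := I) x).mem_iff.1
    (hu.mem_nhds hx)
  exact ⟨⟨f, f.contMDiff⟩, hf, f.eventuallyEq_one⟩

theorem exists_section {x : M} {u : Set M} (hu : IsOpen u) (hx : x ∈ u) {s : ∀ y, V y}
    (hs : ContMDiffOn I (I.prod 𝓘(ℝ, F)) ∞ (fun y ↦ TotalSpace.mk' F y (s y)) u) :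
    ∃ t : Cₛ^∞⟮I; F, V⟯, ∀ᶠ y in 𝓝 x, t y = s y := by
  obtain ⟨f, hf, h1⟩ := exists_bump (I := I) hu hx
  refine ⟨⟨fun y ↦ f y • s y, ?_⟩, h1.mono fun y hy ↦ by
    change f y • s y = s y
    rw [hy, one_smul]⟩
  exact ContMDiffOn.smul_section_of_tsupport f.contMDiff.contMDiffOn hu hf hs

theorem exists_function {x : M} {u : Set M} (hu : IsOpen u) (hx : x ∈ u) {g : M → ℝ}
    (hg : ContMDiffOn I 𝓘(ℝ, ℝ) ∞ g u) :
    ∃ f : C^∞⟮I, M; ℝ⟯, ∀ᶠ y in 𝓝 x, f y = g y := by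
  obtain ⟨t, ht⟩ := exists_section (F := ℝ) (V := Trivial M ℝ) (s := g) hu hx fun y hy ↦
    (contMDiffAt_trivial_iff.2 (hg.contMDiffAt (hu.mem_nhds hy))).contMDiffWithinAt
  exact ⟨⟨t, fun y ↦ contMDiffAt_trivial_iff.1 (t.contMDiff y)⟩, ht⟩

theorem linear_local (φ : Cₛ^∞⟮I; F, V⟯ →ₗ[C^∞⟮I, M; ℝ⟯] C^∞⟮I, M; ℝ⟯)
    (s : Cₛ^∞⟮I; F, V⟯) (x : M) (hs : ∀ᶠ y in 𝓝 x, s y = 0) : φ s x = 0 := by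
  obtain ⟨u, hu, huo, hxu⟩ := eventually_nhds_iff.1 hs
  obtain ⟨f, hf, h1⟩ := exists_bump (I := I) huo hxu
  have h0 : f • s = 0 := by
    ext y
    by_cases hy : y ∈ u
    · simp [hu y hy]
    · have : f y = 0 := image_eq_zero_of_notMem_tsupport fun h ↦ hy (hf h)
      simp [this]
  have h2 : (φ (f • s)) x = 0 := by rw [h0, map_zero]; rfl
  rw [map_smul] at h2
  have h3 : f x * φ s x = 0 := h2
  simpa [h1.self_of_nhds] using h3

variable [ContMDiffVectorBundle ∞ F V I]

theorem exists_frame_section (x : M) (v : F) :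
    ∃ t : Cₛ^∞⟮I; F, V⟯, ∀ᶠ y in 𝓝 x, t y = (trivializationAt F V x).symm y v := by
  set e := trivializationAt F V x
  refine exists_section e.open_baseSet (FiberBundle.mem_baseSet_trivializationAt F V x) ?_
  rw [e.contMDiffOn_section_baseSet_iff]
  refine (contMDiffOn_const (c := v)).congr fun y hy ↦ ?_
  rw [e.apply_mk_symm hy]

theorem exists_section_eq (x : M) (v : V x) : ∃ t : Cₛ^∞⟮I; F, V⟯, t x = v := by
  obtain ⟨t, ht⟩ := exists_frame_section (I := I) (V := V) x (trivializationAt F V x ⟨x, v⟩).2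
  exact ⟨t, by
    rw [ht.self_of_nhds, Trivialization.symm_apply_apply_mk _
      (FiberBundle.mem_baseSet_trivializationAt F V x)]⟩

variable [FiniteDimensional ℝ F]

theorem linear_pointwise (φ : Cₛ^∞⟮I; F, V⟯ →ₗ[C^∞⟮I, M; ℝ⟯] C^∞⟮I, M; ℝ⟯)
    (s : Cₛ^∞⟮I; F, V⟯) (x : M) (hs : s x = 0) : φ s x = 0 := by
  set e := trivializationAt F V x with he
  have hx : x ∈ e.baseSet := FiberBundle.mem_baseSet_trivializationAt F V x
  let b := Module.finBasis ℝ F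
  have hc (i) : ContMDiffOn I 𝓘(ℝ, ℝ) ∞ (fun y ↦ b.repr (e ⟨y, s y⟩).2 i) e.baseSet := by
    have h := e.contMDiffOn_section_baseSet_iff.1 (s.contMDiff.contMDiffOn (s := e.baseSet))
    exact ((b.coord i).toContinuousLinearMap.contDiff.contMDiff).comp_contMDiffOn h
  choose f hf using fun i ↦ exists_function e.open_baseSet hx (hc i)
  choose t ht using fun i ↦ exists_frame_section (I := I) (V := V) x (b i)
  have h := linear_local φ (s - ∑ i, f i • t i) x (by
    filter_upwards [e.open_baseSet.mem_nhds hx, Filter.eventually_all.2 hf,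
      Filter.eventually_all.2 ht] with y hy h1 h2
    have h3 : (∑ i, f i • t i) y = ∑ i, f i y • t i y := by
      rw [← ContMDiffSection.coeAddHom_apply, map_sum, Finset.sum_apply]; rfl
    rw [ContMDiffSection.coe_sub, Pi.sub_apply, h3, sub_eq_zero]
    simp_rw [h1, h2]
    rw [← he]
    have h4 := e.symm_apply_apply_mk hy (s y)
    conv_lhs => rw [← h4, ← b.sum_repr (e ⟨y, s y⟩).2]
    simp only [← e.symmL_apply (R := ℝ) hy, map_sum, map_smul])
  rw [map_sub, map_sum] at h
  have h5 : (φ s) x = (∑ i, φ (f i • t i)) x := sub_eq_zero.1 h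
  have h6 : (∑ i, φ (f i • t i)) x = ∑ i, (φ (f i • t i)) x :=
    map_sum (ContMDiffMap.evalRingHom (I := I) (n := ∞) (R := ℝ) (I' := 𝓘(ℝ, ℝ)) x) _ _
  rw [h5, h6]
  refine Finset.sum_eq_zero fun i _ ↦ ?_
  rw [map_smul]
  change f i x * _ = 0
  have h7 : (e ⟨x, (0 : V x)⟩).2 = 0 := by
    have := congrFun (e.coe_linearMapAt_of_mem (R := ℝ) hx) 0
    rw [← this, map_zero]
  rw [(hf i).self_of_nhds, hs, h7]
  simp

end Global

section Hom

variable [∀ x, IsTopologicalAddGroup (V x)] [∀ x, ContinuousSMul ℝ (V x)]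
  {F₂ : Type*} [NormedAddCommGroup F₂] [NormedSpace ℝ F₂]
  {V₂ : M → Type*} [TopologicalSpace (TotalSpace F₂ V₂)] [∀ x, TopologicalSpace (V₂ x)]
  [∀ x, AddCommGroup (V₂ x)] [∀ x, Module ℝ (V₂ x)] [FiberBundle F₂ V₂] [VectorBundle ℝ F₂ V₂]
  [∀ x, IsTopologicalAddGroup (V₂ x)] [∀ x, ContinuousSMul ℝ (V₂ x)]
  {F₃ : Type*} [NormedAddCommGroup F₃] [NormedSpace ℝ F₃]
  {V₃ : M → Type*} [TopologicalSpace (TotalSpace F₃ V₃)] [∀ x, TopologicalSpace (V₃ x)]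
  [∀ x, AddCommGroup (V₃ x)] [∀ x, Module ℝ (V₃ x)] [FiberBundle F₃ V₃] [VectorBundle ℝ F₃ V₃]
  [∀ x, IsTopologicalAddGroup (V₃ x)] [∀ x, ContinuousSMul ℝ (V₃ x)]

/-- The composition of smooth vector bundle morphisms (over the identity). -/
def homComp (ψ : Cₛ^∞⟮I; F₂ →L[ℝ] F₃, fun x ↦ V₂ x →L[ℝ] V₃ x⟯)
    (φ : Cₛ^∞⟮I; F →L[ℝ] F₂, fun x ↦ V x →L[ℝ] V₂ x⟯) :
    Cₛ^∞⟮I; F →L[ℝ] F₃, fun x ↦ V x →L[ℝ] V₃ x⟯ where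
  toFun x := (ψ x).comp (φ x)
  contMDiff_toFun x := by
    have h1 := ((contMDiffAt_hom_bundle _).1 (ψ.contMDiff x)).2
    have h2 := ((contMDiffAt_hom_bundle _).1 (φ.contMDiff x)).2
    refine (contMDiffAt_hom_bundle _).2 ⟨contMDiffAt_id, (h1.clm_comp h2).congr_of_eventuallyEq ?_⟩
    filter_upwards [(trivializationAt F₂ V₂ x).open_baseSet.mem_nhds
      (FiberBundle.mem_baseSet_trivializationAt F₂ V₂ x)] with y hy
    ext v
    simp only [ContinuousLinearMap.inCoordinates, ContinuousLinearMap.comp_apply]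
    rw [Trivialization.symmL_continuousLinearMapAt _ hy]

/-- The `C^∞(M)`-linear map on sections induced by a smooth vector bundle morphism. -/
def homMap (φ : Cₛ^∞⟮I; F →L[ℝ] F₂, fun x ↦ V x →L[ℝ] V₂ x⟯) :
    Cₛ^∞⟮I; F, V⟯ →ₗ[C^∞⟮I, M; ℝ⟯] Cₛ^∞⟮I; F₂, V₂⟯ where
  toFun s := ⟨fun x ↦ φ x (s x), φ.contMDiff.clm_bundle_apply s.contMDiff⟩
  map_add' s t := by ext x; simp
  map_smul' f s := by ext x; simp

/-- The fibrewise duality pairing `⟨ξ, X⟩ ∈ C^∞(M)` of sections of `A*` and of `A`. -/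
def pairing : Cₛ^∞⟮I; F →L[ℝ] ℝ, DualBundle V⟯ →ₗ[C^∞⟮I, M; ℝ⟯]
    Cₛ^∞⟮I; F, V⟯ →ₗ[C^∞⟮I, M; ℝ⟯] C^∞⟮I, M; ℝ⟯ :=
  LinearMap.mk₂ _
    (fun ξ s ↦ ⟨fun x ↦ ξ x (s x), fun x ↦ contMDiffAt_trivial_iff.1
      ((ξ.contMDiff.clm_bundle_apply s.contMDiff) x)⟩)
    (fun ξ η s ↦ by ext x; rfl) (fun f ξ s ↦ by ext x; rfl)
    (fun ξ s t ↦ by ext x; exact map_add (ξ x) _ _)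
    (fun f ξ s ↦ by ext x; exact map_smul (ξ x) _ _)

@[simp] theorem pairing_apply (ξ : Cₛ^∞⟮I; F →L[ℝ] ℝ, DualBundle V⟯) (s : Cₛ^∞⟮I; F, V⟯) (x : M) :
    pairing ξ s x = ξ x (s x) := rfl

variable [FiniteDimensional ℝ EM] [T2Space M] [IsManifold I ∞ M] [FiniteDimensional ℝ F]
  [ContMDiffVectorBundle ∞ F V I]

theorem contMDiffAt_clm {φ : M → F →L[ℝ] F₂} {x : M}
    (h : ∀ v, ContMDiffAt I 𝓘(ℝ, F₂) ∞ (fun y ↦ φ y v) x) :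
    ContMDiffAt I 𝓘(ℝ, F →L[ℝ] F₂) ∞ φ x := by
  let e₁ := ContinuousLinearEquiv.ofFinrankEq (Module.finrank_fin_fun ℝ (n := Module.finrank ℝ F)).symm
  let e₂ := (e₁.arrowCongr (1 : F₂ ≃L[ℝ] F₂)).trans
    (ContinuousLinearEquiv.piRing (Fin (Module.finrank ℝ F)))
  have h1 : ContMDiffAt I 𝓘(ℝ, Fin (Module.finrank ℝ F) → F₂) ∞ (fun y ↦ e₂ (φ y)) x :=
    contMDiffAt_pi_space.2 fun i ↦ h _
  have h2 := (e₂.symm.contDiff (n := ∞)).contMDiff.contMDiffAt.comp x h1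
  refine h2.congr_of_eventuallyEq (Filter.Eventually.of_forall fun y ↦ ?_)
  simp

theorem contMDiffAt_hom_of_apply {φ : ∀ x, V x →L[ℝ] V₂ x} {x : M}
    (h : ∀ s : Cₛ^∞⟮I; F, V⟯,
      ContMDiffAt I (I.prod 𝓘(ℝ, F₂)) ∞ (fun y ↦ TotalSpace.mk' F₂ y (φ y (s y))) x) :
    ContMDiffAt I (I.prod 𝓘(ℝ, F →L[ℝ] F₂)) ∞
      (fun y ↦ TotalSpace.mk' (F →L[ℝ] F₂) (E := fun y ↦ V y →L[ℝ] V₂ y) y (φ y)) x := by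
  refine (contMDiffAt_hom_bundle _).2 ⟨contMDiffAt_id, contMDiffAt_clm fun v ↦ ?_⟩
  obtain ⟨t, ht⟩ := exists_frame_section (I := I) (V := V) x v
  refine ((contMDiffAt_section x).1 (h t)).congr_of_eventuallyEq ?_
  filter_upwards [ht, (trivializationAt F₂ V₂ x).open_baseSet.mem_nhds
      (FiberBundle.mem_baseSet_trivializationAt F₂ V₂ x),
    (trivializationAt F V x).open_baseSet.mem_nhds
      (FiberBundle.mem_baseSet_trivializationAt F V x)] with y hy h2 h1
  simp only [ContinuousLinearMap.inCoordinates, ContinuousLinearMap.comp_apply]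
  rw [Trivialization.symmL_apply _ h1, hy, Trivialization.continuousLinearMapAt_apply,
    Trivialization.coe_linearMapAt_of_mem _ h2]

theorem contMDiffAt_section_of_dual {s : ∀ x, V x} {x : M}
    (h : ∀ ξ : Cₛ^∞⟮I; F →L[ℝ] ℝ, DualBundle V⟯, ContMDiffAt I 𝓘(ℝ, ℝ) ∞ (fun y ↦ ξ y (s y)) x) :
    ContMDiffAt I (I.prod 𝓘(ℝ, F)) ∞ (fun y ↦ TotalSpace.mk' F y (s y)) x := by
  rw [contMDiffAt_section]
  set e := trivializationAt F V x
  have hx : x ∈ e.baseSet := FiberBundle.mem_baseSet_trivializationAt F V x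
  let b := Module.finBasis ℝ F
  have key (i) : ContMDiffAt I 𝓘(ℝ, ℝ) ∞ (fun y ↦ b.repr (e ⟨y, s y⟩).2 i) x := by
    let ℓ : F →L[ℝ] ℝ := (b.coord i).toContinuousLinearMap
    let ζ : ∀ y, DualBundle V y := fun y ↦ ℓ.comp (e.continuousLinearMapAt ℝ y)
    have hζ (y) (hy : y ∈ e.baseSet) (v : V y) : ζ y v = b.repr (e ⟨y, v⟩).2 i := by
      change ℓ (e.continuousLinearMapAt ℝ y v) = _
      rw [Trivialization.continuousLinearMapAt_apply, Trivialization.coe_linearMapAt_of_mem _ hy]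
      rfl
    obtain ⟨ξ, hξ⟩ := exists_section (I := I) (F := F →L[ℝ] ℝ) (V := DualBundle V) (s := ζ)
      e.open_baseSet hx (by
        intro y hy
        refine (contMDiffAt_hom_of_apply fun t ↦ contMDiffAt_trivial_iff.2 ?_).contMDiffWithinAt
        have h1 := (e.contMDiffAt_section_iff hy).1 (t.contMDiff y)
        refine (ℓ.contDiff.contMDiff.contMDiffAt.comp y h1).congr_of_eventuallyEq ?_
        filter_upwards [e.open_baseSet.mem_nhds hy] with z hz
        exact hζ z hz _)
    refine (h ξ).congr_of_eventuallyEq ?_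
    filter_upwards [hξ, e.open_baseSet.mem_nhds hx] with y hy h2
    rw [hy, hζ y h2]
  have h3 : ContMDiffAt I 𝓘(ℝ, Fin (Module.finrank ℝ F) → ℝ) ∞
      (fun y ↦ b.equivFunL (e ⟨y, s y⟩).2) x := contMDiffAt_pi_space.2 key
  refine ((b.equivFunL.symm.contDiff (n := ∞)).contMDiff.contMDiffAt.comp x
    h3).congr_of_eventuallyEq (Filter.Eventually.of_forall fun y ↦ ?_)
  simp


theorem linear_fibre (φ : Cₛ^∞⟮I; F, V⟯ →ₗ[C^∞⟮I, M; ℝ⟯] C^∞⟮I, M; ℝ⟯) (x : M) :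
    ∃ L : V x →ₗ[ℝ] ℝ, ∀ s, φ s x = L (s x) := by
  choose t ht using fun v : V x ↦ exists_section_eq (I := I) (F := F) x v
  have key (s s' : Cₛ^∞⟮I; F, V⟯) (h : s x = s' x) : φ s x = φ s' x := by
    have h1 := linear_pointwise φ (s - s') x (by
      rw [ContMDiffSection.coe_sub, Pi.sub_apply, h, sub_self])
    rw [map_sub] at h1
    exact sub_eq_zero.1 h1
  refine ⟨{ toFun := fun v ↦ φ (t v) x, map_add' := fun v w ↦ ?_, map_smul' := fun c v ↦ ?_ },
    fun s ↦ key _ _ (ht _).symm⟩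
  · rw [key (t (v + w)) (t v + t w) (by simp [ht]), map_add]; rfl
  · rw [key (t (c • v)) ((ContMDiffMap.const c : C^∞⟮I, M; ℝ⟯) • t v) (by
      rw [section_smul_apply, ht, ht]; rfl), map_smul]
    rfl

theorem pairing_bijective : Function.Bijective
    (pairing (I := I) (F := F) (V := V) : _ → Module.Dual C^∞⟮I, M; ℝ⟯ Cₛ^∞⟮I; F, V⟯) := by
  constructor
  · intro ξ η h
    ext x v
    obtain ⟨t, rfl⟩ := exists_section_eq (I := I) (F := F) x v
    exact congrArg (fun g : C^∞⟮I, M; ℝ⟯ ↦ g x) (LinearMap.congr_fun h t)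
  · intro φ
    choose L hL using linear_fibre φ
    have (x : M) : T2Space (V x) := FiberBundle.t2Space F V x
    have (x : M) : FiniteDimensional ℝ (V x) := VectorBundle.finiteDimensional ℝ F V x
    let ζ : ∀ x, DualBundle V x := fun x ↦ (L x).toContinuousLinearMap
    refine ⟨⟨ζ, fun x ↦ contMDiffAt_hom_of_apply fun s ↦ contMDiffAt_trivial_iff.2 ?_⟩, ?_⟩
    · exact ((φ s).contMDiff x).congr_of_eventuallyEq
        (Filter.Eventually.of_forall fun y ↦ (hL y s).symm)
    · ext s x
      exact (hL x s).symm

theorem pairing_flip_bijective : Function.Bijective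
    (pairing (I := I) (F := F) (V := V)).flip := by
  have (x : M) : T2Space (V x) := FiberBundle.t2Space F V x
  have (x : M) : FiniteDimensional ℝ (V x) := VectorBundle.finiteDimensional ℝ F V x
  constructor
  · intro s t h
    ext x
    refine (Module.forall_dual_apply_eq_zero_iff ℝ (s x - t x)).1 (fun f ↦ ?_) |> sub_eq_zero.1
    obtain ⟨ξ, hξ⟩ := exists_section_eq (I := I) (F := F →L[ℝ] ℝ) (V := DualBundle V) x
      f.toContinuousLinearMap
    have h1 : ξ x (s x) = ξ x (t x) :=
      congrArg (fun g : C^∞⟮I, M; ℝ⟯ ↦ g x) (LinearMap.congr_fun h ξ)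
    rw [hξ] at h1
    rw [map_sub]
    exact sub_eq_zero.2 h1
  · intro φ
    have h1 (x : M) : ∃ v : V x, ∀ ξ : Cₛ^∞⟮I; F →L[ℝ] ℝ, DualBundle V⟯, φ ξ x = ξ x v := by
      obtain ⟨L, hL⟩ := linear_fibre φ x
      let L' : Module.Dual ℝ (Module.Dual ℝ (V x)) :=
        L.comp (LinearMap.toContinuousLinearMap : (V x →ₗ[ℝ] ℝ) ≃ₗ[ℝ] (V x →L[ℝ] ℝ)).toLinearMap
      refine ⟨(Module.evalEquiv ℝ (V x)).symm L', fun ξ ↦ ?_⟩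
      rw [hL]
      exact ((Module.apply_evalEquiv_symm_apply (R := ℝ) (M := V x)
        (ξ x : V x →ₗ[ℝ] ℝ) L')).symm
    choose v hv using h1
    refine ⟨⟨v, fun x ↦ contMDiffAt_section_of_dual fun ξ ↦ ?_⟩, ?_⟩
    · exact ((φ ξ).contMDiff x).congr_of_eventuallyEq
        (Filter.Eventually.of_forall fun y ↦ (hv y ξ).symm)
    · ext ξ x
      exact (hv x ξ).symm

variable (I F V) in
/-- Sections of `A*` are the `C^∞(M)`-linear forms on sections of `A`. -/
def dualEquiv : Cₛ^∞⟮I; F →L[ℝ] ℝ, DualBundle V⟯ ≃ₗ[C^∞⟮I, M; ℝ⟯]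
    Module.Dual C^∞⟮I, M; ℝ⟯ Cₛ^∞⟮I; F, V⟯ :=
  LinearEquiv.ofBijective pairing pairing_bijective

variable (I F V) in
/-- Sections of `A` are the `C^∞(M)`-linear forms on sections of `A*`. -/
def bidualEquiv : Cₛ^∞⟮I; F, V⟯ ≃ₗ[C^∞⟮I, M; ℝ⟯]
    Module.Dual C^∞⟮I, M; ℝ⟯ Cₛ^∞⟮I; F →L[ℝ] ℝ, DualBundle V⟯ :=
  LinearEquiv.ofBijective pairing.flip pairing_flip_bijective

end Hom

section VectorFields

variable [IsManifold I ∞ M]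

theorem contMDiff_derivative (f : C^∞⟮I, M; ℝ⟯) (X : Cₛ^∞⟮I; EM, (TangentSpace I : M → Type _)⟯) :
    ContMDiff I 𝓘(ℝ, ℝ) ∞ (fun x ↦ mvfderiv I f x (X x)) := by
  have h1 := (f.contMDiff.contMDiff_tangentMap (m := ∞) (by simp)).comp X.contMDiff
  exact (contMDiff_snd_tangentBundle_modelSpace ℝ 𝓘(ℝ, ℝ)).comp h1

/-- The derivation `f ↦ X · f` of `C^∞(M)` defined by a smooth vector field `X`. -/
def fieldDer : Cₛ^∞⟮I; EM, (TangentSpace I : M → Type _)⟯ →ₗ[C^∞⟮I, M; ℝ⟯]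
    Derivation ℝ C^∞⟮I, M; ℝ⟯ C^∞⟮I, M; ℝ⟯ where
  toFun X := Derivation.mk'
    { toFun := fun f ↦ ⟨fun x ↦ mvfderiv I f x (X x), contMDiff_derivative f X⟩
      map_add' := fun f g ↦ by
        ext x
        have hf := f.contMDiff.mdifferentiableAt (x := x) (by simp)
        have hg := g.contMDiff.mdifferentiableAt (x := x) (by simp)
        change mvfderiv I (fun y ↦ f y + g y) x (X x) = _
        rw [mvfderiv_fun_add hf hg]
        rfl
      map_smul' := fun c f ↦ by
        ext x
        have hf := f.contMDiff.mdifferentiableAt (x := x) (by simp)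
        have hc : MDifferentiableAt I 𝓘(ℝ, ℝ) (fun _ : M ↦ c) x := mdifferentiableAt_const
        change mvfderiv I (fun y ↦ c * f y) x (X x) = c * mvfderiv I f x (X x)
        rw [mvfderiv_fun_mul hc hf]
        simp [mvfderiv] }
    (fun f g ↦ by
        ext x
        have hf := f.contMDiff.mdifferentiableAt (x := x) (by simp)
        have hg := g.contMDiff.mdifferentiableAt (x := x) (by simp)
        change mvfderiv I (fun y ↦ f y * g y) x (X x) =
          f x * mvfderiv I g x (X x) + g x * mvfderiv I f x (X x)
        rw [mvfderiv_fun_mul hf hg]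
        simp)
  map_add' X Y := by ext f x; exact map_add (mvfderiv I f x) _ _
  map_smul' g X := by ext f x; exact map_smul (mvfderiv I f x) _ _

end VectorFields
end Bundles

section Brackets

/-- The bracket `u ∘_N v = N u ∘ v + u ∘ N v - N (u ∘ v)` deformed by `N`. -/
def deformedBracket {L : Type*} [AddCommGroup L] (br : L → L → L) (N : L → L) (u v : L) : L :=
  br (N u) v + br u (N v) - N (br u v)

/-- The Nijenhuis torsion `(T N)(u, v) = N u ∘ N v - N (u ∘_N v)`. -/
def nijenhuisTorsion {L : Type*} [AddCommGroup L] (br : L → L → L) (N : L → L) (u v : L) : L :=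
  br (N u) (N v) - N (deformedBracket br N u v)

end Brackets

section Poisson

variable {R : Type*} [CommRing R] [Algebra ℝ R]
  {E : Type*} [AddCommGroup E] [Module R E] [Module ℝ E] [IsScalarTower ℝ R E]

/-
Let `E` be a vector bundle with a fibrewise nondegenerate symmetric form `⟨ , ⟩`, and let `𝒜` be the
graded algebra of functions on its minimal symplectic realization, with its Poisson bracket `{ , }`
of degree `-2`. Then `𝒜⁰ = C^∞(M)` and `𝒜¹ = Γ(E)`, with `{u, v} = ⟨u, v⟩`, and an element of `𝒜ᵏ`,
`k ≥ 1`, is determined by its Poisson brackets with `𝒜⁰` and `𝒜¹`. The structures `Deg2` and `Deg3`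
describe the elements of `𝒜²` and `𝒜³` through these brackets. They are written for a module `E`
(the sections) with a form `B` over a commutative real algebra `R` (the smooth functions).
-/

/-- An element `D` of `𝒜²`: the first order operator `op u = {D, u}` on sections together with the
vector field `symbol f = {D, f}`. By the Leibniz rule and the Jacobi identity this is a
covariant differential operator that preserves the form. -/
@[ext] structure Deg2 (B : E →ₗ[R] E →ₗ[R] R) where
  op : E →ₗ[ℝ] E
  symbol : Derivation ℝ R R
  op_smul : ∀ (f : R) (u : E), op (f • u) = f • op u + symbol f • u
  op_metric : ∀ u v, B (op u) v + B u (op v) = symbol (B u v)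

/-- An element `Θ` of `𝒜³`: the derived bracket `bracket u v = {{u, Θ}, v}` of sections, and
`del f = {Θ, f}`, which encodes the anchor `ρ(u) f = {{u, Θ}, f} = ⟨u, del f⟩`.
No condition on `{Θ, Θ}` is imposed. -/
@[ext] structure Deg3 (B : E →ₗ[R] E →ₗ[R] R) where
  bracket : E →ₗ[ℝ] E →ₗ[ℝ] E
  del : Derivation ℝ R E
  bracket_smul : ∀ (f : R) (u v : E), bracket u (f • v) = f • bracket u v + B u (del f) • v
  bracket_metric : ∀ u v w, B (bracket u v) w + B v (bracket u w) = B u (del (B v w))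
  bracket_symm : ∀ u v, bracket u v + bracket v u = del (B u v)

variable {B : E →ₗ[R] E →ₗ[R] R}

instance : Zero (Deg2 B) := ⟨⟨0, 0, by simp, by simp⟩⟩

instance : Zero (Deg3 B) := ⟨⟨0, 0, by simp, by simp, by simp⟩⟩

/-- The element of `𝒜²` of a skew-symmetric endomorphism `N`. It is determined by
`N u = {u, Ñ} = -{Ñ, u}` and `{Ñ, f} = 0`. -/
def Deg2.ofSkew (N : E →ₗ[R] E) (hN : ∀ u v, B (N u) v + B u (N v) = 0) : Deg2 B where
  op := -(N.restrictScalars ℝ)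
  symbol := 0
  op_smul f u := by simp
  op_metric u v := by
    have := hN u v
    simp only [LinearMap.neg_apply, LinearMap.coe_restrictScalars, map_neg, Derivation.coe_zero,
      Pi.zero_apply]
    linear_combination -this

/-- The Poisson bracket `{u, Θ} ∈ 𝒜²` for `u ∈ 𝒜¹` and `Θ ∈ 𝒜³`. -/
def Deg3.bracketSection (Θ : Deg3 B) (u : E) : Deg2 B where
  op := Θ.bracket u
  symbol := Derivation.mk' ((B u).restrictScalars ℝ ∘ₗ (Θ.del : R →ₗ[ℝ] E)) (fun f g ↦ by simp)
  op_smul f v := Θ.bracket_smul f u v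
  op_metric v w := Θ.bracket_metric u v w

/-- The Poisson bracket `{D, Θ} ∈ 𝒜³` for `D ∈ 𝒜²` and `Θ ∈ 𝒜³`. As `{D, ·}` is a derivation of
the Poisson bracket,
`{{u, {D, Θ}}, v} = {D, {{u, Θ}, v}} - {{{D, u}, Θ}, v} - {{u, Θ}, {D, v}}` and
`{{D, Θ}, f} = {D, {Θ, f}} - {Θ, {D, f}}`. -/
def Deg2.bracketDeg3 (D : Deg2 B) (Θ : Deg3 B) : Deg3 B where
  bracket := Θ.bracket.compr₂ D.op - Θ.bracket ∘ₗ D.op - Θ.bracket.compl₂ D.op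
  del := Derivation.mk'
    (D.op ∘ₗ (Θ.del : R →ₗ[ℝ] E) - (Θ.del : R →ₗ[ℝ] E) ∘ₗ (D.symbol : R →ₗ[ℝ] R)) (fun f g ↦ by
      simp [D.op_smul, smul_sub]; abel)
  bracket_smul f u v := by
    have h := D.op_metric u (Θ.del f)
    have h' : B u (D.op (Θ.del f)) = D.symbol (B u (Θ.del f)) - B (D.op u) (Θ.del f) :=
      by linear_combination h
    simp [D.op_smul, Θ.bracket_smul, smul_sub, h', sub_smul]; abel
  bracket_metric u v w := by
    have h1 := D.op_metric (Θ.bracket u v) w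
    have h2 := D.op_metric v (Θ.bracket u w)
    have h3 := Θ.bracket_metric (D.op u) v w
    have h4 := Θ.bracket_metric u (D.op v) w
    have h5 := Θ.bracket_metric u v (D.op w)
    have h6 := D.op_metric u (Θ.del (B v w))
    have h7 := congrArg (fun g ↦ B u (Θ.del g)) (D.op_metric v w)
    have h8 := congrArg D.symbol (Θ.bracket_metric u v w)
    simp only [map_add] at h7 h8
    simp
    linear_combination h1 + h2 - h3 - h4 - h5 - h6 - h7 + h8
  bracket_symm u v := by
    have h1 := congrArg D.op (Θ.bracket_symm u v)
    have h2 := Θ.bracket_symm (D.op u) v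
    have h3 := Θ.bracket_symm u (D.op v)
    have h4 := congrArg Θ.del (D.op_metric u v)
    simp only [map_add] at h1 h4
    simp
    rw [← h1, ← h4, ← h2, ← h3]
    abel

/-- `Θ` is a Courant algebroid structure: `{Θ, Θ} = 0`. The element `{Θ, Θ}` of `𝒜⁴` vanishes if and
only if its brackets with all sections `u` and all functions `f` vanish. Up to nonzero factors these
are `{{u, Θ}, Θ}` and `{{Θ, f}, Θ}`. The first vanishes for all `u` exactly when the derived bracket
satisfies the Jacobi identity and is compatible with `del`. -/
def Deg3.IsCourant (Θ : Deg3 B) : Prop :=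
  (∀ u : E, (Θ.bracketSection u).bracketDeg3 Θ = 0) ∧
    ∀ f : R, Θ.bracketSection (Θ.del f) = 0

end Poisson

section Double

variable {R : Type*} [CommRing R] [Algebra ℝ R]
  {P : Type*} [AddCommGroup P] [Module R P] [Module ℝ P] [IsScalarTower ℝ R P]
  {Q : Type*} [AddCommGroup Q] [Module R Q] [Module ℝ Q] [IsScalarTower ℝ R Q]

variable (R P) in
/-- The algebraic data of a skew-symmetric bracket with anchor on the module `P` of sections of a
bundle. The Jacobi identity is not included. -/
structure AnchoredBracket where
  rho : P →ₗ[R] Derivation ℝ R R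
  bracket : P →ₗ[ℝ] P →ₗ[ℝ] P
  bracket_self : ∀ X, bracket X X = 0
  bracket_smul : ∀ (X : P) (f : R) (Y : P), bracket X (f • Y) = f • bracket X Y + rho X f • Y

namespace AnchoredBracket

variable (μ : AnchoredBracket R P) (e : Q ≃ₗ[R] Module.Dual R P)

theorem bracket_swap (X Y : P) : μ.bracket X Y = -μ.bracket Y X := by
  have h := μ.bracket_self (X + Y)
  simp only [map_add, LinearMap.add_apply, μ.bracket_self] at h
  rw [eq_neg_iff_add_eq_zero]
  simpa [add_comm] using h

theorem smul_bracket (X : P) (f : R) (Y : P) :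
    μ.bracket (f • X) Y = f • μ.bracket X Y - μ.rho Y f • X := by
  rw [μ.bracket_swap, μ.bracket_smul, μ.bracket_swap Y X]
  simp [sub_eq_add_neg]
  abel

/-- The differential `d f ∈ Γ(A*)` of a function, `⟨d f, X⟩ = ρ(X) · f`. -/
def dFun (f : R) : Q :=
  e.symm
    { toFun := fun X ↦ μ.rho X f
      map_add' := fun X Y ↦ by simp
      map_smul' := fun g X ↦ by simp }

/-- The Lie derivative `L_X η`, `⟨L_X η, Z⟩ = ρ(X) · ⟨η, Z⟩ - ⟨η, [X, Z]⟩`. -/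
def lieDer (X : P) (η : Q) : Q :=
  e.symm
    { toFun := fun Z ↦ μ.rho X (e η Z) - e η (μ.bracket X Z)
      map_add' := fun Z W ↦ by simp; ring
      map_smul' := fun g Z ↦ by simp [μ.bracket_smul]; ring }

/-- The contraction `i_Y d ξ`,
`(d ξ)(Y, Z) = ρ(Y) · ⟨ξ, Z⟩ - ρ(Z) · ⟨ξ, Y⟩ - ⟨ξ, [Y, Z]⟩`. -/
def contrD (Y : P) (ξ : Q) : Q :=
  e.symm
    { toFun := fun Z ↦ μ.rho Y (e ξ Z) - μ.rho Z (e ξ Y) - e ξ (μ.bracket Y Z)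
      map_add' := fun Z W ↦ by simp; ring
      map_smul' := fun g Z ↦ by simp [μ.bracket_smul]; ring }

@[simp] theorem dFun_apply (f : R) (X : P) : e (μ.dFun e f) X = μ.rho X f := by
  simp [dFun]

@[simp] theorem lieDer_apply (X : P) (η : Q) (Z : P) :
    e (μ.lieDer e X η) Z = μ.rho X (e η Z) - e η (μ.bracket X Z) := by
  simp [lieDer]

@[simp] theorem contrD_apply (Y : P) (ξ : Q) (Z : P) :
    e (μ.contrD e Y ξ) Z = μ.rho Y (e ξ Z) - μ.rho Z (e ξ Y) - e ξ (μ.bracket Y Z) := by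
  simp [contrD]

end AnchoredBracket

variable (e : Q ≃ₗ[R] Module.Dual R P)

/-- The canonical symmetric form `⟨X + ξ, Y + η⟩ = ⟨ξ, Y⟩ + ⟨η, X⟩`. -/
def dualForm : (P × Q) →ₗ[R] (P × Q) →ₗ[R] R :=
  LinearMap.mk₂ R (fun u v ↦ e u.2 v.1 + e v.2 u.1)
    (fun u v w ↦ by simp; ring) (fun f u v ↦ by simp; ring)
    (fun u v w ↦ by simp; ring) (fun f u v ↦ by simp; ring)

@[simp] theorem dualForm_apply (u v : P × Q) : dualForm e u v = e u.2 v.1 + e v.2 u.1 := rfl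

theorem dualForm_ext {e : Q ≃ₗ[R] Module.Dual R P} {e' : P ≃ₗ[R] Module.Dual R Q}
    (h : ∀ X ξ, e' X ξ = e ξ X) {u v : P × Q}
    (huv : ∀ w, dualForm e u w = dualForm e v w) : u = v := by
  refine Prod.ext (e'.injective (LinearMap.ext fun ζ ↦ ?_)) (e.injective (LinearMap.ext fun Z ↦ ?_))
  · simpa [h] using huv (0, ζ)
  · simpa using huv (Z, 0)

/-- The double of the brackets `μ` on `A` and `γ` on `A*`: the bracket on `A ⊕ A*` with
`[X, Y] = [X, Y]_μ`, `[X, η] = -i_η d_γ X + L^μ_X η`, `[ξ, Y] = L^γ_ξ Y - i_Y d_μ ξ` and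
`[ξ, η] = [ξ, η]_γ`. -/
def doubleBracket (e : Q ≃ₗ[R] Module.Dual R P) (e' : P ≃ₗ[R] Module.Dual R Q)
    (μ : AnchoredBracket R P) (γ : AnchoredBracket R Q) (u v : P × Q) : P × Q :=
  (μ.bracket u.1 v.1 + γ.lieDer e' u.2 v.1 - γ.contrD e' v.2 u.1,
    γ.bracket u.2 v.2 + μ.lieDer e u.1 v.2 - μ.contrD e v.1 u.2)

theorem dualForm_doubleBracket (e : Q ≃ₗ[R] Module.Dual R P) (e' : P ≃ₗ[R] Module.Dual R Q)
    (h : ∀ X ξ, e' X ξ = e ξ X)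
    (μ : AnchoredBracket R P) (γ : AnchoredBracket R Q) (u v w : P × Q) :
    dualForm e (doubleBracket e e' μ γ u v) w =
      e (γ.bracket u.2 v.2) w.1 +
      (μ.rho u.1 (e v.2 w.1) - e v.2 (μ.bracket u.1 w.1)) -
      (μ.rho v.1 (e u.2 w.1) - μ.rho w.1 (e u.2 v.1) - e u.2 (μ.bracket v.1 w.1)) +
      e w.2 (μ.bracket u.1 v.1) +
      (γ.rho u.2 (e w.2 v.1) - e (γ.bracket u.2 w.2) v.1) -
      (γ.rho v.2 (e w.2 u.1) - γ.rho w.2 (e v.2 u.1) - e (γ.bracket v.2 w.2) u.1) := by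
  have h1 : ∀ ξ Y, e w.2 (γ.lieDer e' ξ Y) = γ.rho ξ (e w.2 Y) - e (γ.bracket ξ w.2) Y :=
    fun ξ Y ↦ by rw [← h, AnchoredBracket.lieDer_apply, h, h]
  have h2 : ∀ η X, e w.2 (γ.contrD e' η X) =
      γ.rho η (e w.2 X) - γ.rho w.2 (e η X) - e (γ.bracket η w.2) X :=
    fun η X ↦ by rw [← h, AnchoredBracket.contrD_apply, h, h, h]
  simp only [doubleBracket, dualForm_apply, map_add, map_sub, LinearMap.add_apply,
    LinearMap.sub_apply, AnchoredBracket.lieDer_apply, AnchoredBracket.contrD_apply, h1, h2]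
  ring

theorem dualForm_dFun (e : Q ≃ₗ[R] Module.Dual R P) (e' : P ≃ₗ[R] Module.Dual R Q)
    (h : ∀ X ξ, e' X ξ = e ξ X)
    (μ : AnchoredBracket R P) (γ : AnchoredBracket R Q) (f : R) (w : P × Q) :
    dualForm e (γ.dFun e' f, μ.dFun e f) w = μ.rho w.1 f + γ.rho w.2 f := by
  rw [dualForm_apply, AnchoredBracket.dFun_apply, ← h, AnchoredBracket.dFun_apply]

theorem dualForm_comm (u v : P × Q) : dualForm e u v = dualForm e v u := by
  simp [add_comm]

theorem coe_smul_of_tower (e : Q ≃ₗ[R] Module.Dual R P) (c : ℝ) (ξ : Q) :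
    e (c • ξ) = c • e ξ :=
  LinearMap.map_smul_of_tower e.toLinearMap c ξ

section

variable (e : Q ≃ₗ[R] Module.Dual R P) (e' : P ≃ₗ[R] Module.Dual R Q)
  (h : ∀ X ξ, e' X ξ = e ξ X) (μ : AnchoredBracket R P) (γ : AnchoredBracket R Q)

/-- The operator `f ↦ d_γ f + d_μ f`. It corresponds to the anchor `X + ξ ↦ ρ_μ(X) + ρ_γ(ξ)`. -/
def doubleDel : Derivation ℝ R (P × Q) :=
  Derivation.mk'
    { toFun := fun f ↦ (γ.dFun e' f, μ.dFun e f)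
      map_add' := fun f g ↦ dualForm_ext h fun w ↦ by
        simp only [map_add, LinearMap.add_apply, dualForm_dFun e e' h]; ring
      map_smul' := fun c f ↦ dualForm_ext h fun w ↦ by
        simp only [LinearMap.map_smul_of_tower, LinearMap.smul_apply, dualForm_dFun e e' h,
          Derivation.map_smul, smul_add, RingHom.id_apply] }
    (fun f g ↦ dualForm_ext h fun w ↦ by
        simp only [map_add, LinearMap.add_apply, map_smul, LinearMap.smul_apply, LinearMap.coe_mk,
          AddHom.coe_mk, dualForm_dFun e e' h, Derivation.leibniz, smul_eq_mul]; ring)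

theorem dualForm_doubleDel (f : R) (w : P × Q) :
    dualForm e (doubleDel e e' h μ γ f) w = μ.rho w.1 f + γ.rho w.2 f :=
  dualForm_dFun e e' h μ γ f w

/-- `doubleBracket` as an `ℝ`-bilinear map. -/
def doubleBilin : (P × Q) →ₗ[ℝ] (P × Q) →ₗ[ℝ] (P × Q) :=
  LinearMap.mk₂ ℝ (doubleBracket e e' μ γ)
    (fun u u' v ↦ dualForm_ext h fun w ↦ by
      simp only [map_add, LinearMap.add_apply, dualForm_doubleBracket e e' h, Prod.fst_add,
        Prod.snd_add, Derivation.add_apply]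
      ring)
    (fun c u v ↦ dualForm_ext h fun w ↦ by
      simp only [LinearMap.map_smul_of_tower, LinearMap.smul_apply, dualForm_doubleBracket e e' h,
        Prod.smul_fst, Prod.smul_snd, map_smul, Derivation.smul_apply, smul_sub, smul_add,
        coe_smul_of_tower, Derivation.map_smul])
    (fun u v v' ↦ dualForm_ext h fun w ↦ by
      simp only [map_add, LinearMap.add_apply, dualForm_doubleBracket e e' h, Prod.fst_add,
        Prod.snd_add, Derivation.add_apply]
      ring)
    (fun c u v ↦ dualForm_ext h fun w ↦ by
      simp only [LinearMap.map_smul_of_tower, LinearMap.smul_apply, dualForm_doubleBracket e e' h,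
        Prod.smul_fst, Prod.smul_snd, map_smul, Derivation.smul_apply, smul_sub, smul_add,
        coe_smul_of_tower, Derivation.map_smul])

theorem dualForm_doubleBilin (u v w : P × Q) :
    dualForm e (doubleBilin e e' h μ γ u v) w =
      e (γ.bracket u.2 v.2) w.1 +
      (μ.rho u.1 (e v.2 w.1) - e v.2 (μ.bracket u.1 w.1)) -
      (μ.rho v.1 (e u.2 w.1) - μ.rho w.1 (e u.2 v.1) - e u.2 (μ.bracket v.1 w.1)) +
      e w.2 (μ.bracket u.1 v.1) +
      (γ.rho u.2 (e w.2 v.1) - e (γ.bracket u.2 w.2) v.1) -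
      (γ.rho v.2 (e w.2 u.1) - γ.rho w.2 (e v.2 u.1) - e (γ.bracket v.2 w.2) u.1) :=
  dualForm_doubleBracket e e' h μ γ u v w

theorem doubleBilin_smul (f : R) (u v : P × Q) :
    doubleBilin e e' h μ γ u (f • v) =
      f • doubleBilin e e' h μ γ u v + dualForm e u (doubleDel e e' h μ γ f) • v := by
  refine dualForm_ext h fun w ↦ ?_
  have h1 : dualForm e (f • doubleBilin e e' h μ γ u v +
      dualForm e u (doubleDel e e' h μ γ f) • v) w =
      f * dualForm e (doubleBilin e e' h μ γ u v) w +
        dualForm e (doubleDel e e' h μ γ f) u * dualForm e v w := by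
    rw [dualForm_comm e u, map_add, map_smul, map_smul]; rfl
  rw [h1, dualForm_doubleDel, dualForm_doubleBilin, dualForm_doubleBilin, dualForm_apply]
  simp only [Prod.smul_fst, Prod.smul_snd, map_smul, LinearMap.smul_apply, map_add, map_sub,
    LinearMap.add_apply, LinearMap.sub_apply, μ.bracket_smul, γ.bracket_smul,
    μ.smul_bracket, γ.smul_bracket, Derivation.leibniz, smul_eq_mul, Derivation.smul_apply]
  ring

theorem doubleBilin_symm (u v : P × Q) :
    doubleBilin e e' h μ γ u v + doubleBilin e e' h μ γ v u =
      doubleDel e e' h μ γ (dualForm e u v) := by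
  refine dualForm_ext h fun w ↦ ?_
  rw [map_add, LinearMap.add_apply, dualForm_doubleDel, dualForm_doubleBilin, dualForm_doubleBilin,
    dualForm_apply, map_add, map_add, μ.bracket_swap v.1 u.1, γ.bracket_swap v.2 u.2]
  simp only [map_neg, LinearMap.neg_apply]
  ring

theorem doubleBilin_metric (u v w : P × Q) :
    dualForm e (doubleBilin e e' h μ γ u v) w + dualForm e v (doubleBilin e e' h μ γ u w) =
      dualForm e u (doubleDel e e' h μ γ (dualForm e v w)) := by
  rw [dualForm_comm e u, dualForm_comm e v, dualForm_doubleDel, dualForm_doubleBilin,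
    dualForm_doubleBilin, dualForm_apply, map_add, map_add, μ.bracket_swap w.1 v.1,
    γ.bracket_swap w.2 v.2]
  simp only [map_neg, LinearMap.neg_apply]
  ring

/-- The element `μ + γ` of `𝒜³` for `A ⊕ A*` with its canonical form. -/
def doubleOf : Deg3 (dualForm e) where
  bracket := doubleBilin e e' h μ γ
  del := doubleDel e e' h μ γ
  bracket_smul := doubleBilin_smul e e' h μ γ
  bracket_metric := doubleBilin_metric e e' h μ γ
  bracket_symm := doubleBilin_symm e e' h μ γ

end
end Double

section Algebroids

variable {EM : Type*} [NormedAddCommGroup EM] [NormedSpace ℝ EM]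
  {H : Type*} [TopologicalSpace H] {I : ModelWithCorners ℝ EM H}
  {M : Type*} [TopologicalSpace M] [ChartedSpace H M] [IsManifold I ∞ M]
  {F : Type*} [NormedAddCommGroup F] [NormedSpace ℝ F]
  {V : M → Type*} [TopologicalSpace (TotalSpace F V)] [∀ x, TopologicalSpace (V x)]
  [∀ x, AddCommGroup (V x)] [∀ x, Module ℝ (V x)] [FiberBundle F V] [VectorBundle ℝ F V]
  [∀ x, IsTopologicalAddGroup (V x)] [∀ x, ContinuousSMul ℝ (V x)]

variable (I F V) in
/-- An anchor `ρ : A → TM` and a skew-symmetric `ℝ`-bilinear bracket on the smooth sections of `A`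
with `[X, f Y] = f [X, Y] + (ρ(X) · f) Y`. -/
structure SkewAlgebroid where
  anchor : Cₛ^∞⟮I; F →L[ℝ] EM, fun x ↦ V x →L[ℝ] TangentSpace I x⟯
  bracket : Cₛ^∞⟮I; F, V⟯ →ₗ[ℝ] Cₛ^∞⟮I; F, V⟯ →ₗ[ℝ] Cₛ^∞⟮I; F, V⟯
  bracket_self : ∀ X, bracket X X = 0
  bracket_smul : ∀ (X : Cₛ^∞⟮I; F, V⟯) (f : C^∞⟮I, M; ℝ⟯) (Y : Cₛ^∞⟮I; F, V⟯),
    bracket X (f • Y) = f • bracket X Y + fieldDer (homMap anchor X) f • Y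

namespace SkewAlgebroid

/-- `(A, μ)` is a Lie algebroid: the bracket satisfies the Jacobi identity. -/
def IsLie (μ : SkewAlgebroid I F V) : Prop :=
  ∀ X Y Z, μ.bracket X (μ.bracket Y Z) =
    μ.bracket (μ.bracket X Y) Z + μ.bracket Y (μ.bracket X Z)

/-- The zero anchor and the zero bracket. -/
instance : Zero (SkewAlgebroid I F V) :=
  ⟨⟨0, 0, fun _ ↦ rfl, fun X f Y ↦ by
    have h0 : homMap (0 : Cₛ^∞⟮I; F →L[ℝ] EM, fun x ↦ V x →L[ℝ] TangentSpace I x⟯) X = 0 := by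
      ext x
      rfl
    rw [h0, map_zero]
    simp⟩⟩

/-- The deformed structure `μ_N`, with the bracket
`[X, Y]_N = [N X, Y] + [X, N Y] - N [X, Y]` and the anchor `ρ ∘ N`. -/
def deform (μ : SkewAlgebroid I F V) (N : Cₛ^∞⟮I; F →L[ℝ] F, fun x ↦ V x →L[ℝ] V x⟯) :
    SkewAlgebroid I F V where
  anchor := homComp μ.anchor N
  bracket :=
    μ.bracket ∘ₗ (homMap N).restrictScalars ℝ + μ.bracket.compl₂ ((homMap N).restrictScalars ℝ) -
      μ.bracket.compr₂ ((homMap N).restrictScalars ℝ)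
  bracket_self X := by
    have h := μ.bracket_self (homMap N X + X)
    simp only [map_add, LinearMap.add_apply, μ.bracket_self, zero_add, add_zero] at h
    simpa [μ.bracket_self, add_comm] using h
  bracket_smul X f Y := by
    have h0 : homMap (homComp μ.anchor N) X = homMap μ.anchor (homMap N X) := by
      ext x
      rfl
    rw [h0]
    simp [μ.bracket_smul, smul_sub, smul_add]
    abel

/-- The underlying bracket and anchor, as maps on sections. -/
def toAnchored (μ : SkewAlgebroid I F V) : AnchoredBracket C^∞⟮I, M; ℝ⟯ Cₛ^∞⟮I; F, V⟯ where
  rho := fieldDer ∘ₗ homMap μ.anchor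
  bracket := μ.bracket
  bracket_self := μ.bracket_self
  bracket_smul := μ.bracket_smul

/-- The Lie algebroid `(A, μ)` is irreducible: every vector bundle endomorphism `ψ` of `A` with
`ψ [X, Y] = [X, ψ Y]` for all sections is a constant multiple of the identity. -/
def IsIrreducible (μ : SkewAlgebroid I F V) : Prop :=
  ∀ ψ : Cₛ^∞⟮I; F →L[ℝ] F, fun x ↦ V x →L[ℝ] V x⟯,
    (∀ X Y, homMap ψ (μ.bracket X Y) = μ.bracket X (homMap ψ Y)) →
      ∃ c : ℝ, ∀ x v, ψ x v = c • v

/-- The Nijenhuis torsion `T_μ N` of an endomorphism `N` of `A`. -/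
def torsion (μ : SkewAlgebroid I F V) (N : Cₛ^∞⟮I; F →L[ℝ] F, fun x ↦ V x →L[ℝ] V x⟯)
    (X Y : Cₛ^∞⟮I; F, V⟯) : Cₛ^∞⟮I; F, V⟯ :=
  nijenhuisTorsion (fun X Y ↦ μ.bracket X Y) (homMap N) X Y

/-- A cps (complex, paracomplex or subtangent) structure on `(A, μ)`: `J² = ε Id` with
`ε ∈ {-1, 1, 0}`, and the Nijenhuis torsion of `J` vanishes. -/
def IsCps (μ : SkewAlgebroid I F V) (J : Cₛ^∞⟮I; F →L[ℝ] F, fun x ↦ V x →L[ℝ] V x⟯) : Prop :=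
  (∃ ε : ℝ, (ε = -1 ∨ ε = 1 ∨ ε = 0) ∧ ∀ x v, J x (J x v) = ε • v) ∧
    ∀ X Y, μ.torsion J X Y = 0

/-- `N` is proportional to a cps structure on `(A, μ)`. -/
def IsProportionalToCps (μ : SkewAlgebroid I F V)
    (N : Cₛ^∞⟮I; F →L[ℝ] F, fun x ↦ V x →L[ℝ] V x⟯) : Prop :=
  ∃ (c : ℝ) (J : Cₛ^∞⟮I; F →L[ℝ] F, fun x ↦ V x →L[ℝ] V x⟯), μ.IsCps J ∧ N = c • J

end SkewAlgebroid

variable [FiniteDimensional ℝ EM] [T2Space M] [FiniteDimensional ℝ F]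
  [ContMDiffVectorBundle ∞ F V I]

variable (I F V) in
/-- The smooth sections of `A ⊕ A*`. -/
abbrev DoubleSections : Type _ := Cₛ^∞⟮I; F, V⟯ × Cₛ^∞⟮I; F →L[ℝ] ℝ, DualBundle V⟯

variable (I F V) in
/-- The canonical form `⟨X + ξ, Y + η⟩ = ⟨ξ, Y⟩ + ⟨η, X⟩` on sections of `A ⊕ A*`. -/
abbrev doubleForm : DoubleSections I F V →ₗ[C^∞⟮I, M; ℝ⟯] DoubleSections I F V →ₗ[C^∞⟮I, M; ℝ⟯]
    C^∞⟮I, M; ℝ⟯ :=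
  dualForm (dualEquiv I F V)

/-- The double of `((A, μ), (A*, γ))`: the element `μ + γ` of `𝒜³`, whose derived bracket is the
Dorfman bracket on sections of `A ⊕ A*`. -/
def double (μ : SkewAlgebroid I F V) (γ : SkewAlgebroid I (F →L[ℝ] ℝ) (DualBundle V)) :
    Deg3 (doubleForm I F V) :=
  doubleOf (dualEquiv I F V) (bidualEquiv I F V) (fun _ _ ↦ rfl) μ.toAnchored γ.toAnchored

/-- `((A, μ), (A*, γ))` is a Lie bialgebroid: `(A, μ)` and `(A*, γ)` are Lie algebroids and
`{μ, γ} = 0`. As `{μ, μ} = 0` and `{γ, γ} = 0`, the last condition says that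
`{μ + γ, μ + γ} = 2 {μ, γ}` vanishes. -/
def IsLieBialgebroid (μ : SkewAlgebroid I F V)
    (γ : SkewAlgebroid I (F →L[ℝ] ℝ) (DualBundle V)) : Prop :=
  μ.IsLie ∧ γ.IsLie ∧ (double μ γ).IsCourant

/-- The transpose `ᵗN` on sections of `A*`, `⟨ᵗN ξ, X⟩ = ⟨ξ, N X⟩`. -/
def transposeMap (N : Cₛ^∞⟮I; F →L[ℝ] F, fun x ↦ V x →L[ℝ] V x⟯) :
    Cₛ^∞⟮I; F →L[ℝ] ℝ, DualBundle V⟯ →ₗ[C^∞⟮I, M; ℝ⟯] Cₛ^∞⟮I; F →L[ℝ] ℝ, DualBundle V⟯ where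
  toFun ξ := homComp ξ N
  map_add' ξ η := by ext x v; rfl
  map_smul' f ξ := by ext x v; rfl

/-- The endomorphism `𝒩 (X + ξ) = N X - ᵗN ξ` on sections of `A ⊕ A*`. -/
def doubleEndo (N : Cₛ^∞⟮I; F →L[ℝ] F, fun x ↦ V x →L[ℝ] V x⟯) :
    DoubleSections I F V →ₗ[C^∞⟮I, M; ℝ⟯] DoubleSections I F V :=
  (homMap N).prodMap (-transposeMap N)

theorem doubleEndo_skew (N : Cₛ^∞⟮I; F →L[ℝ] F, fun x ↦ V x →L[ℝ] V x⟯)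
    (u v : DoubleSections I F V) :
    doubleForm I F V (doubleEndo N u) v + doubleForm I F V u (doubleEndo N v) = 0 := by
  have h (ξ : Cₛ^∞⟮I; F →L[ℝ] ℝ, DualBundle V⟯) (X : Cₛ^∞⟮I; F, V⟯) :
      dualEquiv I F V (transposeMap N ξ) X = dualEquiv I F V ξ (homMap N X) := rfl
  simp only [dualForm_apply, doubleEndo, LinearMap.prodMap_apply, LinearMap.neg_apply, map_neg, h]
  ring

/-- The element `Ñ` of `𝒜²` that corresponds to `𝒩`. -/
def doubleTilde (N : Cₛ^∞⟮I; F →L[ℝ] F, fun x ↦ V x →L[ℝ] V x⟯) : Deg2 (doubleForm I F V) :=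
  Deg2.ofSkew (doubleEndo N) (doubleEndo_skew N)

end Algebroids

end

end DoubleDeformation

open DoubleDeformation

/-! Everything reduces to an explicit formula for the double of `μ` and `0`. Its `A`-component is
the bracket of `μ`, and its `A*`-component is known once it is paired with an arbitrary section `Z`
of `A`. Identities on `A ⊕ A*` thus become identities between functions, involving only the bracket
and anchor of `μ`.

Substituting `𝒩` into that formula gives (i) directly (`deformedBracket_doubleBilin_snd`). For the
torsion (`nijenhuisTorsion_doubleBilin_snd`), only two things survive: the torsion of `N` itself,
and the failure of `N²` to commute with the bracket and to be compatible with the anchor. If `N =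
cJ` with `J` cps, then `N²` is a real constant times the identity and both vanish, which is (iii).
Conversely, pairing a section of `A` with one of `A*` forces `N²[X, Z] = [X, N²Z]`; irreducibility
makes `N²` a constant `k`, and dividing `N` by `√|k|` (when `k ≠ 0`) produces the cps structure of
(iv).

For (ii), vanishing torsion gives the Jacobi identity for `μ_N` (`deformedBracket_jacobi`), and the
double of any Lie algebroid with the zero structure is Courant (`doubleOf_isCourant`). The latter
needs the anchor to preserve brackets, which follows from Jacobi and Leibniz
(`SkewAlgebroid.IsLie.rho_bracket`). Part (v) adds the equality of `{Ñ, μ}` with the double of `μ_N`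
(`double_deform_eq_bracketDeg3`). -/

namespace DoubleDeformation

set_option linter.unusedSectionVars false

/-! ### Brackets deformed by an endomorphism with vanishing torsion. -/

section Nijenhuis

variable {P : Type*} [AddCommGroup P] [Module ℝ P]

/-- The bracket deformed by an endomorphism with vanishing torsion satisfies the Jacobi identity. -/
theorem deformedBracket_jacobi (b : P →ₗ[ℝ] P →ₗ[ℝ] P)
    (hb : ∀ X Y Z, b X (b Y Z) = b (b X Y) Z + b Y (b X Z)) (n : P →ₗ[ℝ] P)
    (hn : ∀ X Y, nijenhuisTorsion (fun X Y ↦ b X Y) n X Y = 0) (X Y Z : P) :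
    deformedBracket (fun X Y ↦ b X Y) n X (deformedBracket (fun X Y ↦ b X Y) n Y Z) =
      deformedBracket (fun X Y ↦ b X Y) n (deformedBracket (fun X Y ↦ b X Y) n X Y) Z +
        deformedBracket (fun X Y ↦ b X Y) n Y (deformedBracket (fun X Y ↦ b X Y) n X Z) := by
  -- Oriented as a rewrite rule that eliminates every `[n X, n Y]`.
  simp only [nijenhuisTorsion, deformedBracket, map_add, map_sub, sub_eq_zero] at hn
  have h1 := hb (n X) (n Y) Z
  have h2 := hb (n X) Y (n Z)
  have h3 := hb X (n Y) (n Z)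
  have h4 := congrArg n (hb (n X) Y Z)
  have h5 := congrArg n (hb X (n Y) Z)
  have h6 := congrArg n (hb X Y (n Z))
  have h7 := congrArg n (congrArg n (hb X Y Z))
  simp only [deformedBracket, map_add, map_sub, LinearMap.add_apply, LinearMap.sub_apply, hn]
    at h1 h2 h3 h4 h5 h6 h7 ⊢
  -- The deformed Jacobi identity is the sum of the Jacobi identities with `n` in two slots, minus
  -- `n` of those with `n` in one slot, plus `n²` of the original one.
  linear_combination (norm := module) h1 + h2 + h3 - h4 - h5 - h6 + h7

/-- Every term of the torsion is quadratic in the endomorphism. This lets vanishing torsion pass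
between `N` and its rescalings. -/
theorem nijenhuisTorsion_smul (b : P →ₗ[ℝ] P →ₗ[ℝ] P) (n : P →ₗ[ℝ] P) (c : ℝ) (X Y : P) :
    nijenhuisTorsion (fun X Y ↦ b X Y) (c • n) X Y =
      (c * c) • nijenhuisTorsion (fun X Y ↦ b X Y) n X Y := by
  simp only [nijenhuisTorsion, deformedBracket, Pi.smul_apply, LinearMap.smul_apply, map_add,
    map_sub, map_smul, smul_sub, smul_add, mul_smul]

end Nijenhuis

/-! ### The Poisson bracket with a skew endomorphism, as a deformation. -/

section Deformation

variable {R : Type*} [CommRing R] [Algebra ℝ R]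
  {E : Type*} [AddCommGroup E] [Module R E] [Module ℝ E] [IsScalarTower ℝ R E]
  {B : E →ₗ[R] E →ₗ[R] R} (Θ : Deg3 B) (N : E →ₗ[R] E) (hN : ∀ u v, B (N u) v + B u (N v) = 0)

/-- The operator attached to the endomorphism is `{Ñ, ·} = -N`, so the three terms of the Poisson
bracket acquire exactly the signs of the deformed bracket. -/
theorem ofSkew_bracketDeg3_bracket (u v : E) :
    ((Deg2.ofSkew N hN).bracketDeg3 Θ).bracket u v =
      deformedBracket (fun u v ↦ Θ.bracket u v) N u v := by
  simp only [deformedBracket, Deg2.bracketDeg3, Deg2.ofSkew, LinearMap.sub_apply,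
    LinearMap.compr₂_apply, LinearMap.compl₂_apply, LinearMap.comp_apply, LinearMap.neg_apply,
    LinearMap.coe_restrictScalars, map_neg]
  abel

theorem ofSkew_bracketDeg3_del (f : R) :
    ((Deg2.ofSkew N hN).bracketDeg3 Θ).del f = -N (Θ.del f) := by
  simp [Deg2.bracketDeg3, Deg2.ofSkew]

end Deformation

/-! ### The double with zero structure on the dual, in components. -/

section Algebraic

variable {R : Type*} [CommRing R] [Algebra ℝ R]
  {P : Type*} [AddCommGroup P] [Module R P] [Module ℝ P] [IsScalarTower ℝ R P]
  {Q : Type*} [AddCommGroup Q] [Module R Q] [Module ℝ Q] [IsScalarTower ℝ R Q]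
  (e : Q ≃ₗ[R] Module.Dual R P) (e' : P ≃ₗ[R] Module.Dual R Q)
  (h : ∀ X ξ, e' X ξ = e ξ X) (μ : AnchoredBracket R P) (γ : AnchoredBracket R Q)

/-- Pairing with `(0, ζ)` isolates the `A`-component, and pairing with `(Z, 0)` the `A*`-component;
the next three lemmas use the same device. -/
theorem doubleBilin_fst (hγ : γ.bracket = 0) (hρ : γ.rho = 0) (u v : P × Q) :
    (doubleBilin e e' h μ γ u v).1 = μ.bracket u.1 v.1 := by
  refine e'.injective (LinearMap.ext fun ζ ↦ ?_)
  have := dualForm_doubleBilin e e' h μ γ u v (0, ζ)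
  simpa [hγ, hρ, h] using this

theorem doubleBilin_snd (hγ : γ.bracket = 0) (hρ : γ.rho = 0) (u v : P × Q) (Z : P) :
    e (doubleBilin e e' h μ γ u v).2 Z =
      μ.rho u.1 (e v.2 Z) - e v.2 (μ.bracket u.1 Z) -
      (μ.rho v.1 (e u.2 Z) - μ.rho Z (e u.2 v.1) - e u.2 (μ.bracket v.1 Z)) := by
  have := dualForm_doubleBilin e e' h μ γ u v (Z, 0)
  simpa [hγ, hρ, h] using this

theorem doubleDel_fst (hρ : γ.rho = 0) (f : R) : (doubleDel e e' h μ γ f).1 = 0 := by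
  refine e'.injective (LinearMap.ext fun ζ ↦ ?_)
  have := dualForm_doubleDel e e' h μ γ f (0, ζ)
  simpa [hρ, h] using this

theorem doubleDel_snd (f : R) (Z : P) : e (doubleDel e e' h μ γ f).2 Z = μ.rho Z f := by
  have := dualForm_doubleDel e e' h μ γ f (Z, 0)
  simpa [h] using this

/-- The double of a Lie algebroid and the zero structure on the dual is a Courant algebroid. -/
theorem doubleOf_isCourant (hγ : γ.bracket = 0) (hρ : γ.rho = 0)
    (hJ : ∀ X Y Z, μ.bracket X (μ.bracket Y Z) =
      μ.bracket (μ.bracket X Y) Z + μ.bracket Y (μ.bracket X Z))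
    (hA : ∀ X Y f, μ.rho (μ.bracket X Y) f = μ.rho X (μ.rho Y f) - μ.rho Y (μ.rho X f)) :
    (doubleOf e e' h μ γ).IsCourant := by
  have d1 := doubleDel_fst e e' h μ γ hρ
  have d2 := doubleDel_snd e e' h μ γ
  have b1 := doubleBilin_fst e e' h μ γ hγ hρ
  have b2 := doubleBilin_snd e e' h μ γ hγ hρ
  -- Jacobi oriented so as to remove left-nested brackets, which leaves terms that `ring` can
  -- compare.
  have hJe (ξ : Q) (X Y Z : P) : e ξ (μ.bracket (μ.bracket X Y) Z) =
      e ξ (μ.bracket X (μ.bracket Y Z)) - e ξ (μ.bracket Y (μ.bracket X Z)) := by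
    rw [hJ X Y Z, map_add]; ring
  refine ⟨fun u ↦ Deg3.ext ?_ ?_, fun f ↦ Deg2.ext ?_ ?_⟩
  · refine LinearMap.ext fun v ↦ LinearMap.ext fun w ↦ ?_
    -- The four conditions are: the Jacobi identity of the derived bracket, `[u, ∂f] = ∂⟨u, ∂f⟩`,
    -- `[∂f, v] = 0` and `⟨∂f, ∂g⟩ = 0`, where `∂` is `doubleDel`. The last holds because `∂f` lies
    -- in the isotropic summand `A*`.
    change doubleBilin e e' h μ γ u (doubleBilin e e' h μ γ v w) -
      doubleBilin e e' h μ γ (doubleBilin e e' h μ γ u v) w -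
      doubleBilin e e' h μ γ v (doubleBilin e e' h μ γ u w) = 0
    refine Prod.ext ?_ (e.injective (LinearMap.ext fun Z ↦ ?_))
    · simp only [Prod.fst_sub, b1, hJ u.1 v.1 w.1, Prod.fst_zero]
      abel
    · have hs := congrArg (e u.2) (μ.bracket_swap Z w.1)
      have hs' := congrArg (μ.rho v.1) (congrArg (e u.2) (μ.bracket_swap Z w.1))
      simp only [Prod.snd_sub, map_sub, LinearMap.sub_apply, b1, b2, hA, hJe, Prod.snd_zero,
        map_zero, LinearMap.zero_apply, map_neg] at hs hs' ⊢
      ring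
  · refine Derivation.ext fun f ↦ ?_
    change doubleBilin e e' h μ γ u (doubleDel e e' h μ γ f) -
      doubleDel e e' h μ γ (dualForm e u (doubleDel e e' h μ γ f)) = 0
    refine Prod.ext ?_ (e.injective (LinearMap.ext fun Z ↦ ?_))
    · simp [b1, d1]
    · simp only [Prod.snd_sub, map_sub, LinearMap.sub_apply, b2, d1, d2, hA, dualForm_apply,
        Prod.snd_zero, map_zero, LinearMap.zero_apply, Derivation.zero_apply, zero_add]
      ring
  · refine LinearMap.ext fun v ↦ ?_
    change doubleBilin e e' h μ γ (doubleDel e e' h μ γ f) v = 0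
    refine Prod.ext ?_ (e.injective (LinearMap.ext fun Z ↦ ?_))
    · simp [b1, d1]
    · simp only [b2, d1, d2, hA, Prod.snd_zero, map_zero, LinearMap.zero_apply,
        Derivation.zero_apply]
      ring
  · refine Derivation.ext fun g ↦ ?_
    change dualForm e (doubleDel e e' h μ γ f) (doubleDel e e' h μ γ g) = 0
    simp [d1]

/-- Compare Jacobi for `X, Y, fZ` with `f` times Jacobi for `X, Y, Z`: by Leibniz the terms with one
derivative of `f` cancel, and the remaining ones form the defect of the anchor applied to `f`, times
`Z`. -/
theorem rho_bracket_smul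
    (hJ : ∀ X Y Z, μ.bracket X (μ.bracket Y Z) =
      μ.bracket (μ.bracket X Y) Z + μ.bracket Y (μ.bracket X Z)) (X Y Z : P) (f : R) :
    (μ.rho (μ.bracket X Y) f - (μ.rho X (μ.rho Y f) - μ.rho Y (μ.rho X f))) • Z = 0 := by
  have h1 := hJ X Y (f • Z)
  have h2 := congrArg (f • ·) (hJ X Y Z)
  simp only [μ.bracket_smul, map_add, smul_add] at h1 h2
  linear_combination (norm := module) h2 - h1

/-! ### Torsion and deformation of the double by `n ⊕ (-t)`, with `t` the transpose of `n`. -/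

variable (n : P →ₗ[R] P) (t : Q →ₗ[R] Q)

theorem nijenhuisTorsion_doubleBilin_fst (hγ : γ.bracket = 0) (hρ : γ.rho = 0) (u v : P × Q) :
    (nijenhuisTorsion (fun u v ↦ doubleBilin e e' h μ γ u v) (n.prodMap (-t)) u v).1 =
      nijenhuisTorsion (fun X Y ↦ μ.bracket X Y) n u.1 v.1 := by
  simp [nijenhuisTorsion, deformedBracket, doubleBilin_fst e e' h μ γ hγ hρ]

/-- The derivatives along `n u.1` and `n v.1` cancel between `[𝒩u, 𝒩v]` and `𝒩[u, v]_𝒩`. The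
brackets that remain regroup into the torsion of `n` and the commutator of `n²` with the bracket.
Both directions of the torsion statement are read off from this formula. -/
theorem nijenhuisTorsion_doubleBilin_snd (hγ : γ.bracket = 0) (hρ : γ.rho = 0)
    (ht : ∀ ξ X, e (t ξ) X = e ξ (n X)) (u v : P × Q) (Z : P) :
    e (nijenhuisTorsion (fun u v ↦ doubleBilin e e' h μ γ u v) (n.prodMap (-t)) u v).2 Z =
      e v.2 (n (n (μ.bracket u.1 Z)) - μ.bracket u.1 (n (n Z)) -
        nijenhuisTorsion (fun X Y ↦ μ.bracket X Y) n u.1 Z) -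
      e u.2 (n (n (μ.bracket v.1 Z)) - μ.bracket v.1 (n (n Z)) -
        nijenhuisTorsion (fun X Y ↦ μ.bracket X Y) n v.1 Z) +
      (μ.rho (n (n Z)) (e u.2 v.1) - μ.rho Z (e u.2 (n (n v.1)))) := by
  simp only [nijenhuisTorsion, deformedBracket, LinearMap.prodMap_apply, Prod.snd_sub,
    Prod.snd_add, map_sub, map_add, LinearMap.neg_apply, map_neg, LinearMap.sub_apply,
    LinearMap.add_apply, ht, doubleBilin_snd e e' h μ γ hγ hρ]
  ring

theorem deformedBracket_doubleBilin_fst (hγ : γ.bracket = 0) (hρ : γ.rho = 0) (u v : P × Q) :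
    (deformedBracket (fun u v ↦ doubleBilin e e' h μ γ u v) (n.prodMap (-t)) u v).1 =
      deformedBracket (fun X Y ↦ μ.bracket X Y) n u.1 v.1 := by
  simp [deformedBracket, doubleBilin_fst e e' h μ γ hγ hρ]

/-- The derivatives along `u.1` in `[u, 𝒩v]` and `𝒩[u, v]` cancel, so only the one along `n u.1` is
left: this is why the deformed anchor is `ρ ∘ N`. -/
theorem deformedBracket_doubleBilin_snd (hγ : γ.bracket = 0) (hρ : γ.rho = 0)
    (ht : ∀ ξ X, e (t ξ) X = e ξ (n X)) (u v : P × Q) (Z : P) :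
    e (deformedBracket (fun u v ↦ doubleBilin e e' h μ γ u v) (n.prodMap (-t)) u v).2 Z =
      μ.rho (n u.1) (e v.2 Z) - e v.2 (deformedBracket (fun X Y ↦ μ.bracket X Y) n u.1 Z) -
      (μ.rho (n v.1) (e u.2 Z) - μ.rho (n Z) (e u.2 v.1) -
        e u.2 (deformedBracket (fun X Y ↦ μ.bracket X Y) n v.1 Z)) := by
  simp only [deformedBracket, LinearMap.prodMap_apply, Prod.snd_sub,
    Prod.snd_add, map_sub, map_add, LinearMap.neg_apply, map_neg, LinearMap.sub_apply,
    LinearMap.add_apply, ht, doubleBilin_snd e e' h μ γ hγ hρ]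
  ring

end Algebraic

/-! ### Lie algebroids and their anchors. -/

section Bundle

variable {EM : Type*} [NormedAddCommGroup EM] [NormedSpace ℝ EM]
  {H : Type*} [TopologicalSpace H] {I : ModelWithCorners ℝ EM H}
  {M : Type*} [TopologicalSpace M] [ChartedSpace H M] [IsManifold I ∞ M]
  {F : Type*} [NormedAddCommGroup F] [NormedSpace ℝ F]
  {V : M → Type*} [TopologicalSpace (TotalSpace F V)] [∀ x, TopologicalSpace (V x)]
  [∀ x, AddCommGroup (V x)] [∀ x, Module ℝ (V x)] [FiberBundle F V] [VectorBundle ℝ F V]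
  [∀ x, IsTopologicalAddGroup (V x)] [∀ x, ContinuousSMul ℝ (V x)]

theorem toAnchored_zero_bracket : (0 : SkewAlgebroid I F V).toAnchored.bracket = 0 := rfl

theorem toAnchored_zero_rho : (0 : SkewAlgebroid I F V).toAnchored.rho = 0 := by
  refine LinearMap.ext fun X ↦ ?_
  have h0 : homMap (0 : Cₛ^∞⟮I; F →L[ℝ] EM, fun x ↦ V x →L[ℝ] TangentSpace I x⟯) X = 0 := by
    ext x
    rfl
  change fieldDer (homMap (0 : Cₛ^∞⟮I; F →L[ℝ] EM, fun x ↦ V x →L[ℝ] TangentSpace I x⟯) X) = 0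
  rw [h0, map_zero]

theorem zero_isLie : (0 : SkewAlgebroid I F V).IsLie := fun _ _ _ ↦ (add_zero _).symm

theorem SkewAlgebroid.toAnchored_deform_rho (μ : SkewAlgebroid I F V)
    (N : Cₛ^∞⟮I; F →L[ℝ] F, fun x ↦ V x →L[ℝ] V x⟯) (X : Cₛ^∞⟮I; F, V⟯) :
    (μ.deform N).toAnchored.rho X = μ.toAnchored.rho (homMap N X) := rfl

theorem SkewAlgebroid.deform_isLie {μ : SkewAlgebroid I F V} (hμ : μ.IsLie)
    {N : Cₛ^∞⟮I; F →L[ℝ] F, fun x ↦ V x →L[ℝ] V x⟯} (hN : ∀ X Y, μ.torsion N X Y = 0) :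
    (μ.deform N).IsLie :=
  deformedBracket_jacobi μ.bracket hμ ((homMap N).restrictScalars ℝ) hN

theorem SkewAlgebroid.torsion_smul (μ : SkewAlgebroid I F V) (c : ℝ)
    (N : Cₛ^∞⟮I; F →L[ℝ] F, fun x ↦ V x →L[ℝ] V x⟯) (X Y : Cₛ^∞⟮I; F, V⟯) :
    μ.torsion (c • N) X Y = (c * c) • μ.torsion N X Y :=
  nijenhuisTorsion_smul μ.bracket ((homMap N).restrictScalars ℝ) c X Y

variable [FiniteDimensional ℝ EM] [T2Space M] [FiniteDimensional ℝ F]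
  [ContMDiffVectorBundle ∞ F V I]

/-- A function that annihilates all sections vanishes, or the bundle has rank zero. -/
theorem eq_zero_or_subsingleton_of_smul_eq_zero {g : C^∞⟮I, M; ℝ⟯}
    (hg : ∀ Z : Cₛ^∞⟮I; F, V⟯, g • Z = 0) : g = 0 ∨ Subsingleton Cₛ^∞⟮I; F, V⟯ := by
  by_cases h0 : g = 0
  · exact Or.inl h0
  right
  obtain ⟨x, hx⟩ : ∃ x, g x ≠ 0 := by
    by_contra! hc
    exact h0 (ContMDiffMap.ext hc)
  have hV : Subsingleton (V x) := by
    refine ⟨fun v w ↦ ?_⟩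
    have hv (v : V x) : v = 0 := by
      obtain ⟨Z, rfl⟩ := exists_section_eq (I := I) (F := F) x v
      have h1 : g x • Z x = 0 := congrArg (fun s : Cₛ^∞⟮I; F, V⟯ ↦ s x) (hg Z)
      exact (smul_eq_zero.1 h1).resolve_left hx
    rw [hv v, hv w]
  -- All fibres are modelled on the same `F`, so one zero fibre makes every fibre zero, even if `M`
  -- is disconnected.
  have hequiv (y : M) : V y ≃ F :=
    ((trivializationAt F V y).continuousLinearEquivAt ℝ y
      (FiberBundle.mem_baseSet_trivializationAt F V y)).toEquiv
  have hF : Subsingleton F := (hequiv x).symm.subsingleton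
  have hVy (y : M) : Subsingleton (V y) := (hequiv y).subsingleton
  exact ⟨fun s s' ↦ ContMDiffSection.ext fun y ↦ Subsingleton.elim _ _⟩

/-- The defect annihilates every section by `rho_bracket_smul`, hence vanishes in positive rank; in
rank zero all sections are `0` and both sides are trivial. -/
theorem SkewAlgebroid.IsLie.rho_bracket {μ : SkewAlgebroid I F V} (hμ : μ.IsLie)
    (X Y : Cₛ^∞⟮I; F, V⟯) (f : C^∞⟮I, M; ℝ⟯) :
    μ.toAnchored.rho (μ.bracket X Y) f =
      μ.toAnchored.rho X (μ.toAnchored.rho Y f) - μ.toAnchored.rho Y (μ.toAnchored.rho X f) := by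
  rcases eq_zero_or_subsingleton_of_smul_eq_zero
    (fun Z ↦ rho_bracket_smul μ.toAnchored hμ X Y Z f) with h | h
  · exact sub_eq_zero.1 h
  · rw [Subsingleton.elim (μ.bracket X Y) 0, Subsingleton.elim X 0, Subsingleton.elim Y 0]
    simp

theorem SkewAlgebroid.IsLie.isLieBialgebroid {μ : SkewAlgebroid I F V} (hμ : μ.IsLie) :
    IsLieBialgebroid μ 0 :=
  ⟨hμ, zero_isLie, doubleOf_isCourant _ _ _ _ _ toAnchored_zero_bracket toAnchored_zero_rho hμ
    hμ.rho_bracket⟩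

theorem bidualEquiv_apply_apply (X : Cₛ^∞⟮I; F, V⟯) (ξ : Cₛ^∞⟮I; F →L[ℝ] ℝ, DualBundle V⟯) :
    bidualEquiv I F V X ξ = dualEquiv I F V ξ X := rfl

/-! ### The double of the deformed structure. -/

variable (μ : SkewAlgebroid I F V) (N : Cₛ^∞⟮I; F →L[ℝ] F, fun x ↦ V x →L[ℝ] V x⟯)

theorem deformedBracket_double (u v : DoubleSections I F V) :
    deformedBracket (fun u v ↦ (double μ 0).bracket u v) (doubleEndo N) u v =
      (double (μ.deform N) 0).bracket u v := by
  refine Prod.ext ?_ ((dualEquiv I F V).injective (LinearMap.ext fun Z ↦ ?_))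
  · exact (deformedBracket_doubleBilin_fst _ _ bidualEquiv_apply_apply μ.toAnchored _ (homMap N) (transposeMap N)
      toAnchored_zero_bracket toAnchored_zero_rho u v).trans
      (doubleBilin_fst _ _ bidualEquiv_apply_apply (μ.deform N).toAnchored _ toAnchored_zero_bracket
        toAnchored_zero_rho u v).symm
  · exact (deformedBracket_doubleBilin_snd _ _ bidualEquiv_apply_apply μ.toAnchored _ (homMap N) (transposeMap N)
      toAnchored_zero_bracket toAnchored_zero_rho (fun _ _ ↦ rfl) u v Z).trans
      (doubleBilin_snd _ _ bidualEquiv_apply_apply (μ.deform N).toAnchored _ toAnchored_zero_bracket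
        toAnchored_zero_rho u v Z).symm

theorem double_deform_eq_bracketDeg3 :
    double (μ.deform N) 0 = (doubleTilde N).bracketDeg3 (double μ 0) := by
  refine Deg3.ext (LinearMap.ext fun u ↦ LinearMap.ext fun v ↦ ?_) (Derivation.ext fun f ↦ ?_)
  · exact (deformedBracket_double μ N u v).symm.trans
      (ofSkew_bracketDeg3_bracket (double μ 0) _ _ u v).symm
  · refine Eq.trans ?_ (ofSkew_bracketDeg3_del (double μ 0) _ _ f).symm
    refine Prod.ext ?_ ((dualEquiv I F V).injective (LinearMap.ext fun Z ↦ ?_))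
    · have h1 := doubleDel_fst (dualEquiv I F V) (bidualEquiv I F V) bidualEquiv_apply_apply μ.toAnchored
        _ toAnchored_zero_rho f
      have h2 := doubleDel_fst (dualEquiv I F V) (bidualEquiv I F V) bidualEquiv_apply_apply
        (μ.deform N).toAnchored _ toAnchored_zero_rho f
      exact h2.trans ((congrArg (fun X ↦ -homMap N X) h1).trans (by simp)).symm
    · have h1 := doubleDel_snd (dualEquiv I F V) (bidualEquiv I F V) bidualEquiv_apply_apply μ.toAnchored
        (0 : SkewAlgebroid I (F →L[ℝ] ℝ) (DualBundle V)).toAnchored f (homMap N Z)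
      have h2 := doubleDel_snd (dualEquiv I F V) (bidualEquiv I F V) bidualEquiv_apply_apply
        (μ.deform N).toAnchored (0 : SkewAlgebroid I (F →L[ℝ] ℝ) (DualBundle V)).toAnchored f Z
      -- `⟨d_μ f, N Z⟩ = ρ(N Z) f = ⟨d_{μ_N} f, Z⟩`, that is, the deformed differential of `f` is
      -- `ᵗN d_μ f`.
      rw [← SkewAlgebroid.toAnchored_deform_rho, ← h2] at h1
      refine h1.symm.trans ?_
      -- One sign comes from `{Ñ, ·} = -𝒩`, the other from `𝒩 = -ᵗN` on `A*`.
      change dualEquiv I F V (transposeMap N _) Z = dualEquiv I F V (-(-transposeMap N _)) Z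
      rw [neg_neg]
      rfl

/-! ### Cps structures and the torsion of the double. -/

theorem SkewAlgebroid.IsProportionalToCps.torsion_eq_zero {μ : SkewAlgebroid I F V}
    {N : Cₛ^∞⟮I; F →L[ℝ] F, fun x ↦ V x →L[ℝ] V x⟯} (hN : μ.IsProportionalToCps N)
    (X Y : Cₛ^∞⟮I; F, V⟯) : μ.torsion N X Y = 0 := by
  obtain ⟨c, J, ⟨-, hJ⟩, rfl⟩ := hN
  rw [μ.torsion_smul, hJ, smul_zero]

theorem SkewAlgebroid.IsProportionalToCps.exists_sq {μ : SkewAlgebroid I F V}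
    {N : Cₛ^∞⟮I; F →L[ℝ] F, fun x ↦ V x →L[ℝ] V x⟯} (hN : μ.IsProportionalToCps N) :
    ∃ k : ℝ, ∀ X, homMap N (homMap N X) = k • X := by
  obtain ⟨c, J, ⟨⟨ε, -, hJ⟩, -⟩, rfl⟩ := hN
  refine ⟨c * c * ε, fun X ↦ ContMDiffSection.ext fun x ↦ ?_⟩
  change c • J x (c • J x (X x)) = (c * c * ε) • X x
  rw [map_smul, hJ, smul_smul, smul_smul]

theorem nijenhuisTorsion_double_of_isProportionalToCps (hN : μ.IsProportionalToCps N)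
    (u v : DoubleSections I F V) :
    nijenhuisTorsion (fun u v ↦ (double μ 0).bracket u v) (doubleEndo N) u v = 0 := by
  obtain ⟨k, hk⟩ := hN.exists_sq
  have hT (X Y) : nijenhuisTorsion (fun X Y ↦ μ.toAnchored.bracket X Y) (homMap N) X Y = 0 :=
    hN.torsion_eq_zero X Y
  refine Prod.ext ?_ ((dualEquiv I F V).injective (LinearMap.ext fun Z ↦ ?_))
  · exact (nijenhuisTorsion_doubleBilin_fst _ _ bidualEquiv_apply_apply μ.toAnchored _ (homMap N) (transposeMap N)
      toAnchored_zero_bracket toAnchored_zero_rho u v).trans (hT _ _)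
  · refine (nijenhuisTorsion_doubleBilin_snd _ _ bidualEquiv_apply_apply μ.toAnchored _ (homMap N) (transposeMap N)
      toAnchored_zero_bracket toAnchored_zero_rho (fun _ _ ↦ rfl) u v Z).trans ?_
    -- That `k` is a real constant matters here: it passes through the bracket and the derivations
    -- without a Leibniz term.
    simp only [hT, hk, map_smul, sub_self, map_zero, LinearMap.map_smul_of_tower,
      Derivation.map_smul, Derivation.smul_apply, Prod.snd_zero,
      LinearMap.zero_apply, add_zero]

/-- For `k ≠ 0` the endomorphism `N / √|k|` squares to the sign `k / |k|`; for `k = 0`, `N` itself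
is subtangent. Rescaling preserves vanishing torsion. -/
theorem isProportionalToCps_of_sq (hT : ∀ X Y, μ.torsion N X Y = 0) {k : ℝ}
    (hk : ∀ x v, N x (N x v) = k • v) : μ.IsProportionalToCps N := by
  rcases eq_or_ne k 0 with rfl | h0
  · exact ⟨1, N, ⟨⟨0, by simp, hk⟩, hT⟩, (one_smul ℝ N).symm⟩
  have ha : √|k| ≠ 0 := Real.sqrt_ne_zero'.2 (abs_pos.2 h0)
  have hsq : √|k| * √|k| = |k| := Real.mul_self_sqrt (abs_nonneg k)
  refine ⟨√|k|, (√|k|)⁻¹ • N, ⟨⟨k / |k|, ?_, fun x v ↦ ?_⟩, fun X Y ↦ ?_⟩, ?_⟩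
  · rcases h0.lt_or_gt with hk0 | hk0
    · left; rw [abs_of_neg hk0, div_neg, div_self h0]
    · right; left; rw [abs_of_pos hk0, div_self h0]
  · change (√|k|)⁻¹ • N x ((√|k|)⁻¹ • N x v) = _
    rw [map_smul, hk, smul_smul, smul_smul, ← mul_inv, hsq, div_eq_inv_mul]
  · rw [μ.torsion_smul, hT, smul_zero]
  · rw [smul_smul, mul_inv_cancel₀ ha, one_smul]

theorem isProportionalToCps_of_nijenhuisTorsion_double (hμ : μ.IsIrreducible)
    (h : ∀ u v : DoubleSections I F V,
      nijenhuisTorsion (fun u v ↦ (double μ 0).bracket u v) (doubleEndo N) u v = 0) :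
    μ.IsProportionalToCps N := by
  have hT (X Y) : nijenhuisTorsion (fun X Y ↦ μ.toAnchored.bracket X Y) (homMap N) X Y = 0 :=
    (nijenhuisTorsion_doubleBilin_fst _ _ bidualEquiv_apply_apply μ.toAnchored _ (homMap N) (transposeMap N)
      toAnchored_zero_bracket toAnchored_zero_rho (X, 0) (Y, 0)).symm.trans
      (congrArg Prod.fst (h (X, 0) (Y, 0)))
  have hcomm (X Z : Cₛ^∞⟮I; F, V⟯) :
      homMap (homComp N N) (μ.bracket X Z) = μ.bracket X (homMap (homComp N N) Z) := by
    refine sub_eq_zero.1 ((bidualEquiv I F V).injective (LinearMap.ext fun η ↦ ?_))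
    -- With `u = X` in `A` and `v = η` in `A*`, the terms in `u.2` and `v.1` drop out. Since the
    -- torsion of `N` is already zero, what is left is `⟨η, N²[X, Z] - [X, N²Z]⟩ = 0`.
    have h1 := nijenhuisTorsion_doubleBilin_snd (dualEquiv I F V) (bidualEquiv I F V)
      bidualEquiv_apply_apply μ.toAnchored _ (homMap N) (transposeMap N)
      toAnchored_zero_bracket toAnchored_zero_rho (fun _ _ ↦ rfl) (X, 0) (0, η) Z
    have h2 := congrArg (fun w ↦ dualEquiv I F V w.2 Z) (h (X, 0) (0, η))
    have h3 := h1.symm.trans h2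
    simp only [hT, sub_zero, map_zero, LinearMap.zero_apply, add_zero, Prod.snd_zero] at h3
    rw [map_zero]
    exact h3
  obtain ⟨k, hk⟩ := hμ (homComp N N) hcomm
  exact isProportionalToCps_of_sq μ N hT hk

end Bundle

end DoubleDeformation

theorem corollary4p4
    -- a smooth manifold `M`
    {EM : Type*} [NormedAddCommGroup EM] [NormedSpace ℝ EM] [FiniteDimensional ℝ EM]
    {H : Type*} [TopologicalSpace H] {I : ModelWithCorners ℝ EM H}
    {M : Type*} [TopologicalSpace M] [ChartedSpace H M] [IsManifold I ∞ M] [T2Space M]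
    -- a smooth vector bundle `A → M` of finite rank, with fibres `V x` and typical fibre `F`
    {F : Type*} [NormedAddCommGroup F] [NormedSpace ℝ F] [FiniteDimensional ℝ F]
    {V : M → Type*} [TopologicalSpace (TotalSpace F V)] [∀ x, TopologicalSpace (V x)]
    [∀ x, AddCommGroup (V x)] [∀ x, Module ℝ (V x)]
    [∀ x, IsTopologicalAddGroup (V x)] [∀ x, ContinuousSMul ℝ (V x)]
    [FiberBundle F V] [VectorBundle ℝ F V] [ContMDiffVectorBundle ∞ F V I]
    -- a Lie algebroid structure on `A` and a vector bundle endomorphism of `A`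
    (μ : SkewAlgebroid I F V) (hμ : μ.IsLie)
    (N : Cₛ^∞⟮I; F →L[ℝ] F, fun x ↦ V x →L[ℝ] V x⟯) :
    -- (i)
    (∀ u v : DoubleSections I F V,
      deformedBracket (fun u v ↦ (double μ 0).bracket u v) (doubleEndo N) u v =
        (double (μ.deform N) 0).bracket u v) ∧
    -- (ii)
    ((∀ X Y, μ.torsion N X Y = 0) → IsLieBialgebroid (μ.deform N) 0) ∧
    -- (iii)
    (μ.IsProportionalToCps N → ∀ u v : DoubleSections I F V,
      nijenhuisTorsion (fun u v ↦ (double μ 0).bracket u v) (doubleEndo N) u v = 0) ∧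
    -- (iv)
    (μ.IsIrreducible →
      (∀ u v : DoubleSections I F V,
        nijenhuisTorsion (fun u v ↦ (double μ 0).bracket u v) (doubleEndo N) u v = 0) →
      μ.IsProportionalToCps N) ∧
    -- (v)
    (μ.IsProportionalToCps N →
      IsLieBialgebroid (μ.deform N) 0 ∧
      ((doubleTilde N).bracketDeg3 (double μ 0)).IsCourant ∧
      double (μ.deform N) 0 = (doubleTilde N).bracketDeg3 (double μ 0)) := by
  have h5 (hN : μ.IsProportionalToCps N) : IsLieBialgebroid (μ.deform N) 0 :=
    (SkewAlgebroid.deform_isLie hμ hN.torsion_eq_zero).isLieBialgebroid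
  refine ⟨deformedBracket_double μ N, fun hN ↦ (SkewAlgebroid.deform_isLie hμ hN).isLieBialgebroid,
    nijenhuisTorsion_double_of_isProportionalToCps μ N,
    isProportionalToCps_of_nijenhuisTorsion_double μ N, fun hN ↦ ⟨h5 hN, ?_, ?_⟩⟩
  -- The Courant property is carried over from the double of `μ_N`, where it is part of being a Lie
  -- bialgebroid.
  · rw [← double_deform_eq_bracketDeg3]
    exact (h5 hN).2.2
  · exact double_deform_eq_bracketDeg3 μ N
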